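/- Let $d\geq 4$, and let $\bar R:\mathbb R^d\to\mathbb R$ be a probability density that is even, compactly supported and Hölder continuous, i.e. $|\bar R(x)-\bar R(y)|\le C|x-y|_2^h$ for all $x,y\in\mathbb R^d$ and some constants $h,C>0$. Let $R=\bar R*\bar R$, and let $\xi_1$ be a continuous, centered, stationary Gaussian process on $\mathbb R^d$ with covariance $\mathbf E[\xi_1(x)\xi_1(y)]=R(x-y)$. For $\varepsilon\in(0,1]$ put $\xi_\varepsilon(x)=\varepsilon^{-d/2}\xi_1(x/\varepsilon)$ and $A_\varepsilon=\tfrac12\Delta+\xi_\varepsilon$. For a bounded open set $U\subset\mathbb R^d$ let $\Lambda_1(A_\varepsilon,U)\ge\Lambda_2(A_\varepsilon,U)\ge\cdots$ be the eigenvalues, counted with multiplicity, of $A_\varepsilon$ on $U$ with Dirichlet boundary conditions, and let $Q_t=(-t,t)^d$. Then for every function $t\mapsto\varepsilon(t)\in(0,1]$ $(t\ge0)$ and every integer $k\ge1$, $$\lim_{t\to\infty}\frac{\Lambda_k(A_{\varepsilon(t)},Q_t)}{\varepsilon(t)^{-d/2}\sqrt{\log(t/\varepsilon(t))}}=\sqrt{2d\,R(0)}\qquad\text{in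 probability.}$$ -/

import Mathlib

open MeasureTheory ProbabilityTheory Filter Topology
open scoped ENNReal Gradient Convolution

namespace AndersonHamiltonian

noncomputable section

/-- Euclidean space `ℝᵈ`. -/
abbrev E (d : ℕ) : Type := EuclideanSpace ℝ (Fin d)

/-- `L²(ℝᵈ)`. For a subset `U` of `ℝᵈ`, `L²(U)` is viewed inside it (extension by zero). -/
abbrev L2 (d : ℕ) : Type := Lp ℝ 2 (volume : Measure (E d))

/-- Square integrable vector fields on `ℝᵈ`. -/
abbrev L2Vec (d : ℕ) : Type := Lp (E d) 2 (volume : Measure (E d))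

/-! ### The noise -/

/-- The conditions on the function `Rbar` whose self-convolution is the covariance of the noise:
an even, compactly supported, Hölder continuous probability density. -/
structure IsCovarianceRoot {d : ℕ} (Rbar : E d → ℝ) : Prop where
  nonneg : ∀ x, 0 ≤ Rbar x
  integral_eq_one : ∫ x, Rbar x = 1
  even : ∀ x, Rbar (-x) = Rbar x
  hasCompactSupport : HasCompactSupport Rbar
  holder : ∃ h : ℝ, 0 < h ∧ ∃ C : ℝ, 0 < C ∧ ∀ x y, |Rbar x - Rbar y| ≤ C * ‖x - y‖ ^ h

/-- The covariance function `R = Rbar * Rbar` (convolution). -/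
def covarianceFun {d : ℕ} (Rbar : E d → ℝ) : E d → ℝ := Rbar ⋆ Rbar

/-- `ξ` is a continuous centered Gaussian process on `ℝᵈ` with covariance
`𝐄[ξ(x) ξ(y)] = R(x - y)`. Stationarity is a consequence, since the law of a centered Gaussian
process is determined by its covariance. -/
structure IsStationaryGaussianNoise {d : ℕ} {Ω : Type*} [MeasurableSpace Ω] (P : Measure Ω)
    (R : E d → ℝ) (ξ : E d → Ω → ℝ) : Prop where
  gaussian : IsGaussianProcess ξ P
  centered : ∀ x, ∫ ω, ξ x ω ∂P = 0
  covariance : ∀ x y, ∫ ω, ξ x ω * ξ y ω ∂P = R (x - y)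
  continuous_paths : ∀ᵐ ω ∂P, Continuous fun x => ξ x ω

/-- The rescaled noise `ξ_ε(x) = ε^{-d/2} ξ(x / ε)`. -/
def scaledNoise {d : ℕ} {Ω : Type*} (ξ : E d → Ω → ℝ) (ε : ℝ) (ω : Ω) (x : E d) : ℝ :=
  ε ^ (-(d : ℝ) / 2) * ξ (ε⁻¹ • x) ω

/-! ### Dirichlet eigenvalues of `½Δ + V` -/

/-- `φ ∈ C₀^∞(U)`. -/
structure IsTestFunction {d : ℕ} (U : Set (E d)) (φ : E d → ℝ) : Prop where
  smooth : ContDiff ℝ (⊤ : ℕ∞) φ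
  hasCompactSupport : HasCompactSupport φ
  tsupport_subset : tsupport φ ⊆ U

/-- The pairs `(φ, ∇φ)` with `φ ∈ C₀^∞(U)`, as elements of `L² × L²`. -/
def testGraph {d : ℕ} (U : Set (E d)) : Set (L2 d × L2Vec d) :=
  {p | ∃ φ : E d → ℝ, IsTestFunction U φ ∧ p.1 =ᵐ[volume] φ ∧ p.2 =ᵐ[volume] ∇ φ}

/-- The Sobolev space `H¹₀(U)`, the closure of `C₀^∞(U)` in the `H¹`-norm. A function `u` of
`H¹₀(U)` is recorded together with its weak gradient, as the pair `(u, ∇u)`. -/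
def sobolevGraph {d : ℕ} (U : Set (E d)) : Set (L2 d × L2Vec d) := closure (testGraph U)

/-- `u` lies in the domain of the operator `A = ½Δ + V` on `U` with Dirichlet boundary conditions,
and `A u = f` on `U`: one has `u ∈ H¹₀(U)` and `½Δu + Vu = f` weakly in `U`. -/
def IsDirichletImage {d : ℕ} (V : E d → ℝ) (U : Set (E d)) (u f : L2 d) : Prop :=
  ∃ g : L2Vec d, (u, g) ∈ sobolevGraph U ∧
    ∀ φ : E d → ℝ, IsTestFunction U φ →
      (∫ x, V x * u x * φ x) - (1 / 2) * (∫ x, inner ℝ (g x) (∇ φ x)) = ∫ x, f x * φ x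

/-- `u` is an eigenfunction of `½Δ + V` on `U`, with Dirichlet boundary conditions, for the
eigenvalue `μ`. -/
def IsDirichletEigenfunction {d : ℕ} (V : E d → ℝ) (U : Set (E d)) (μ : ℝ) (u : L2 d) : Prop :=
  u ≠ 0 ∧ IsDirichletImage V U u (μ • u)

/-- At least `k` Dirichlet eigenvalues of `½Δ + V` on `U`, counted with multiplicity, are `≥ a`. -/
def HasEigenvaluesAbove {d : ℕ} (V : E d → ℝ) (U : Set (E d)) (k : ℕ) (a : ℝ) : Prop :=
  ∃ u : Fin k → L2 d, LinearIndependent ℝ u ∧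
    ∀ i, ∃ μ : ℝ, a ≤ μ ∧ IsDirichletEigenfunction V U μ (u i)

/-- The `k`-th largest Dirichlet eigenvalue `Λ_k(½Δ + V, U)` (`k ≥ 1`), counted with multiplicity:
the largest `a` such that at least `k` eigenvalues are `≥ a`. -/
def dirichletEigenvalue {d : ℕ} (V : E d → ℝ) (U : Set (E d)) (k : ℕ) : ℝ :=
  sSup {a : ℝ | HasEigenvaluesAbove V U k a}

/-- The open box `Q_t = (-t, t)ᵈ`. -/
def box (d : ℕ) (t : ℝ) : Set (E d) := {x | ∀ i, x i ∈ Set.Ioo (-t) t}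

end

end AndersonHamiltonian

/-! Put `L = t / ε`. After rescaling, the potential on `Q_t` is `ε^{-d/2}` times the fixed process
`ξ₁` seen on `Q_L`, and `ε ≤ 1` forces `L ≥ t → ∞`. The probability therefore concerns `ξ₁` on large
boxes only, where its maximum is of order `√(2 d R(0) log L)`. The theorem says that every fixed
eigenvalue follows this maximum to leading order.

Upper bound: `-½Δ ≥ 0`, so no Dirichlet eigenvalue exceeds the supremum of the potential
(`dirichletEigenvalue_le`). Lower bound: if `ξ₁` is high on `k` disjoint balls of a fixed radius,
then bumps supported in the shrunken balls of radius of order `ε` are test functions for the min-max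
principle (`le_dirichletEigenvalue`). Their kinetic cost is of order `ε^{-2}`, and `d ≥ 4` gives
`ε^{-2} ≤ ε^{-d/2}`; so it is negligible against `ε^{-d/2} √log L`, uniformly in `ε`.
`abs_dirichletEigenvalue_sub_le` combines both bounds for one realisation of the noise.

That deterministic statement asks for three events of high probability. The oscillation of `ξ₁` on
cells of a fine lattice of fixed spacing is at most `δ √log L`: chaining, based on Hölder continuity
of `R` at the origin (`exists_mesh_oscillation`). No lattice value exceeds `(σ + δ) √log L`, where
`σ² = 2 d R(0)`: a union bound over about `L^d` Gaussian tails (`tendsto_measure_mesh_ge`). At least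
`k` lattice values exceed `(σ - δ) √log L`: `R` has compact support, so values at separated points
are independent and a second moment argument applies (`tendsto_measure_not_exists_mesh_ge`).

Eigenvalues are defined through the weak equation, so the lower bound must produce eigenfunctions.
They come from the spectral theorem for the compact solution operator of a coercive form,
compactness being Rellich's theorem for `H¹₀` of a bounded set. -/

namespace AndersonHamiltonian

/-! ### Compact self-adjoint operators and coercive forms. -/

section Spectral

open Module.End

variable {X : Type*} [NormedAddCommGroup X] [InnerProductSpace ℝ X]

/-- On the span of eigenspaces with eigenvalue `< ν₀`, the Rayleigh quotient is `≤ ν₀`. -/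
theorem inner_apply_self_le_of_mem_iSup_eigenspace {T : X →L[ℝ] X}
    (hT : (T : X →ₗ[ℝ] X).IsSymmetric) {ν₀ : ℝ} {f : X}
    (hf : f ∈ ⨆ ν : {ν : ℝ // ν < ν₀}, eigenspace (T : X →ₗ[ℝ] X) ν) :
    inner ℝ (T f) f ≤ ν₀ * ‖f‖ ^ 2 := by
  classical
  obtain ⟨g, hg⟩ := (Submodule.mem_iSup_iff_exists_dfinsupp' _ _).1 hf
  have horth : ∀ i j : {ν : ℝ // ν < ν₀}, i ≠ j → inner ℝ (g i : X) (g j : X) = 0 := by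
    intro i j hij
    have := hT.orthogonalFamily_eigenspaces.comp (γ := {ν : ℝ // ν < ν₀}) (f := Subtype.val)
      Subtype.val_injective
    exact this hij (g i) (g j)
  have hsum : f = ∑ i ∈ g.support, (g i : X) := by rw [← hg, DFinsupp.sum]
  have hT' : T f = ∑ i ∈ g.support, (i : ℝ) • (g i : X) := by
    rw [hsum, map_sum]
    exact Finset.sum_congr rfl fun i _ => mem_eigenspace_iff.1 (g i).2
  have h1 : inner ℝ (T f) f = ∑ i ∈ g.support, (i : ℝ) * ‖(g i : X)‖ ^ 2 := by
    rw [hT', hsum, sum_inner]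
    refine Finset.sum_congr rfl fun i hi => ?_
    rw [inner_smul_left, inner_sum, Finset.sum_eq_single i]
    · simp
    · exact fun j _ hj => horth i j hj.symm
    · exact fun h => (h hi).elim
  have h2 : ‖f‖ ^ 2 = ∑ i ∈ g.support, ‖(g i : X)‖ ^ 2 := by
    rw [← real_inner_self_eq_norm_sq f, hsum, sum_inner]
    refine Finset.sum_congr rfl fun i hi => ?_
    rw [inner_sum, Finset.sum_eq_single i]
    · simp
    · exact fun j _ hj => horth i j hj.symm
    · exact fun h => (h hi).elim
  rw [h1, h2, Finset.mul_sum]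
  exact Finset.sum_le_sum fun i _ => mul_le_mul_of_nonneg_right i.2.le (sq_nonneg _)

/-- A vector orthogonal to all eigenvectors with eigenvalue `≥ ν₀` of a compact symmetric operator
has Rayleigh quotient `≤ ν₀`. -/
theorem inner_apply_self_le_of_orthogonal [CompleteSpace X] {T : X →L[ℝ] X}
    (hT : (T : X →ₗ[ℝ] X).IsSymmetric) (hc : IsCompactOperator T) {ν₀ : ℝ} {f : X}
    (hf : ∀ ν, ν₀ ≤ ν → ∀ e, T e = ν • e → inner ℝ e f = 0) :
    inner ℝ (T f) f ≤ ν₀ * ‖f‖ ^ 2 := by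
  set N : Submodule ℝ X := ⨆ ν : {ν : ℝ // ν < ν₀}, eigenspace (T : X →ₗ[ℝ] X) ν with hN
  have hcl : f ∈ N.topologicalClosure := by
    have hK : CompleteSpace N.topologicalClosure :=
      N.isClosed_topologicalClosure.completeSpace_coe
    set p : X := N.topologicalClosure.starProjection f with hp
    have hp_mem : p ∈ N.topologicalClosure := by
      rw [hp, Submodule.starProjection_apply]; exact Subtype.coe_prop _
    have hfp : f - p ∈ N.topologicalClosureᗮ :=
      Submodule.sub_starProjection_mem_orthogonal f
    have hpo : ∀ ν, ν₀ ≤ ν → ∀ e, T e = ν • e → inner ℝ e p = 0 := by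
      intro ν hν e he
      have hle : N.topologicalClosure ≤ (ℝ ∙ e)ᗮ := by
        refine Submodule.topologicalClosure_minimal _ ?_ (Submodule.isClosed_orthogonal _)
        refine iSup_le fun i => fun x hx => ?_
        rw [Submodule.mem_orthogonal_singleton_iff_inner_right]
        have hne : ν ≠ i := fun h => absurd i.2 (by rw [← h]; exact hν.not_gt)
        exact hT.orthogonalFamily_eigenspaces hne
          ⟨e, mem_eigenspace_iff.2 he⟩ ⟨x, hx⟩
      exact (Submodule.mem_orthogonal_singleton_iff_inner_right).1 (hle hp_mem)
    -- The difference is orthogonal to every eigenspace: for small eigenvalues by the projection,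
    -- for large ones because both `f` and `p` are. The spectral theorem then makes it zero.
    have hz : f - p ∈ (⨆ μ : ℝ, eigenspace (T : X →ₗ[ℝ] X) μ)ᗮ := by
      rw [Submodule.mem_orthogonal]
      intro u hu
      have hle : (⨆ μ : ℝ, eigenspace (T : X →ₗ[ℝ] X) μ) ≤ (ℝ ∙ (f - p))ᗮ := by
        refine iSup_le fun μ => fun x hx => ?_
        rw [Submodule.mem_orthogonal_singleton_iff_inner_left]
        rcases lt_or_ge μ ν₀ with h | h
        · have hx' : x ∈ N := Submodule.mem_iSup_of_mem (⟨μ, h⟩ : {ν : ℝ // ν < ν₀}) hx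
          exact (Submodule.mem_orthogonal _ _).1 hfp x (N.le_topologicalClosure hx')
        · have hx' : T x = μ • x := mem_eigenspace_iff.1 hx
          rw [inner_sub_right, hf μ h x hx', hpo μ h x hx', sub_zero]
      exact (Submodule.mem_orthogonal_singleton_iff_inner_left).1 (hle hu)
    have hbot := ContinuousLinearMap.orthogonalComplement_iSup_eigenspaces_eq_bot hc hT
    rw [hbot, Submodule.mem_bot, sub_eq_zero] at hz
    rw [hz]; exact hp_mem
  have hclosed : IsClosed {f : X | inner ℝ (T f) f ≤ ν₀ * ‖f‖ ^ 2} :=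
    isClosed_le (by fun_prop) (by fun_prop)
  have hsub : (N : Set X) ⊆ {f : X | inner ℝ (T f) f ≤ ν₀ * ‖f‖ ^ 2} := fun x hx =>
    inner_apply_self_le_of_mem_iSup_eigenspace hT hx
  exact closure_minimal hsub hclosed hcl

/-- Either there are `k` linearly independent eigenvectors with eigenvalues `≥ ν₀`, or every
`k`-dimensional subspace contains a nonzero vector with Rayleigh quotient `≤ ν₀`. -/
theorem exists_eigenvectors_or_exists_inner_le [CompleteSpace X] {T : X →L[ℝ] X}
    (hT : (T : X →ₗ[ℝ] X).IsSymmetric) (hc : IsCompactOperator T) (ν₀ : ℝ) (k : ℕ) :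
    (∃ e : Fin k → X, LinearIndependent ℝ e ∧ ∀ i, ∃ ν, ν₀ ≤ ν ∧ T (e i) = ν • e i) ∨
    ∀ w : Fin k → X, LinearIndependent ℝ w → ∃ f ∈ Submodule.span ℝ (Set.range w), f ≠ 0 ∧
      inner ℝ (T f) f ≤ ν₀ * ‖f‖ ^ 2 := by
  set A : Set X := {e | ∃ ν, ν₀ ≤ ν ∧ T e = ν • e} with hA
  obtain ⟨b, hbA, hspan, hli⟩ := exists_linearIndependent ℝ A
  by_cases hk : (k : ℕ∞) ≤ b.encard
  · left
    obtain ⟨b', hb', hcard⟩ := Set.exists_subset_encard_eq hk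
    have hfin : b'.Finite := Set.finite_of_encard_eq_coe hcard
    have : Fintype b' := hfin.fintype
    have hc' : Fintype.card b' = k := by
      rw [← Set.toFinset_card, ← Nat.cast_inj (R := ℕ∞), ← hcard, Set.encard_eq_coe_toFinset_card]
    let eqv := (Fintype.equivFinOfCardEq hc').symm
    refine ⟨fun i => (eqv i : X), ?_, fun i => hbA (hb' (eqv i).2)⟩
    exact (show LinearIndepOn ℝ id b from hli).mono hb' |>.comp eqv eqv.injective
  · right
    intro w hw
    rw [not_le] at hk
    have hfin : b.Finite := Set.finite_of_encard_le_coe hk.le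
    have : Fintype b := hfin.fintype
    have hfr : Module.finrank ℝ (Submodule.span ℝ A) < k := by
      rw [← hspan, finrank_span_set_eq_card hli]
      rw [Set.encard_eq_coe_toFinset_card] at hk
      exact_mod_cast hk
    have : FiniteDimensional ℝ (Submodule.span ℝ A) := by
      rw [← hspan]; exact FiniteDimensional.span_of_finite ℝ hfin
    -- Fewer than `k` independent eigenvectors lie above the threshold, so projecting a
    -- `k`-dimensional space onto their span has a kernel, and a kernel vector is orthogonal to all
    -- of them.
    let φ : Submodule.span ℝ (Set.range w) →ₗ[ℝ] Submodule.span ℝ A :=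
      ((Submodule.span ℝ A).orthogonalProjectionOnto : X →ₗ[ℝ] Submodule.span ℝ A).comp
        (Submodule.span ℝ (Set.range w)).subtype
    have hwr : Module.finrank ℝ (Submodule.span ℝ (Set.range w)) = k := by
      rw [finrank_span_eq_card hw, Fintype.card_fin]
    have : FiniteDimensional ℝ (Submodule.span ℝ (Set.range w)) :=
      FiniteDimensional.span_of_finite ℝ (Set.finite_range w)
    have hker : LinearMap.ker φ ≠ ⊥ := LinearMap.ker_ne_bot_of_finrank_lt (by rw [hwr]; exact hfr)
    obtain ⟨f, hf, hf0⟩ := (Submodule.ne_bot_iff _).1 hker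
    refine ⟨f, f.2, by simpa using hf0, ?_⟩
    refine inner_apply_self_le_of_orthogonal hT hc fun ν hν e he => ?_
    have : (f : X) ∈ (Submodule.span ℝ A)ᗮ := by
      rw [← Submodule.orthogonalProjectionOnto_eq_zero_iff]
      exact hf
    exact (Submodule.mem_orthogonal _ _).1 this e (Submodule.subset_span ⟨ν, hν, he⟩)

/-- Variational construction of eigenvectors of a coercive symmetric form `B` relative to a
compactly embedded Hilbert space. -/
theorem exists_form_eigenvectors {H : Type*} [NormedAddCommGroup H] [InnerProductSpace ℝ H]
    [CompleteSpace H] [CompleteSpace X] (J : H →L[ℝ] X) (hJ : IsCompactOperator J)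
    (B : H →L[ℝ] H →L[ℝ] ℝ) (hB : IsCoercive B) (hsymm : ∀ u v, B u v = B v u)
    {k : ℕ} {c : ℝ} (hc : 0 < c) (w : Fin k → H) (hw : LinearIndependent ℝ (J ∘ w))
    (hlt : ∀ v ∈ Submodule.span ℝ (Set.range w), J v ≠ 0 → B v v < c * ‖J v‖ ^ 2) :
    ∃ u : Fin k → H, LinearIndependent ℝ (J ∘ u) ∧
      ∀ i, ∃ μ ≤ c, ∀ v, B (u i) v = μ * inner ℝ (J (u i)) (J v) := by
  let S := hB.continuousLinearEquivOfBilin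
  -- Lax–Milgram solution operator: `K f` represents `v ↦ ⟨f, J v⟩` with respect to `B`. An
  -- eigenvalue `ν` of `J K` becomes the eigenvalue `ν⁻¹` of `B` relative to `J`, so the smallest
  -- form eigenvalues are the largest ones of a compact operator.
  let K : X →L[ℝ] H := (S.symm : H →L[ℝ] H).comp (ContinuousLinearMap.adjoint J)
  have hK : ∀ f v, B (K f) v = inner ℝ f (J v) := by
    intro f v
    rw [← hB.continuousLinearEquivOfBilin_apply]
    simp only [K, S, ContinuousLinearMap.comp_apply, ContinuousLinearEquiv.coe_coe,
      ContinuousLinearEquiv.apply_symm_apply]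
    exact ContinuousLinearMap.adjoint_inner_left J v f
  let T : X →L[ℝ] X := J.comp K
  have hTin : ∀ f g, inner ℝ (T f) g = B (K g) (K f) := by
    intro f g
    rw [hK, real_inner_comm]; rfl
  have hTs : (T : X →ₗ[ℝ] X).IsSymmetric := by
    intro f g
    change inner ℝ (T f) g = inner ℝ f (T g)
    rw [hTin, real_inner_comm, hTin, hsymm]
  have hTc : IsCompactOperator T := hJ.comp_clm K
  rcases exists_eigenvectors_or_exists_inner_le hTs hTc c⁻¹ k with ⟨e, he, hev⟩ | h
  · choose ν hν hTe using hev
    have hνpos : ∀ i, 0 < ν i := fun i => (inv_pos.2 hc).trans_le (hν i)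
    have hJu : ∀ i, J ((ν i)⁻¹ • K (e i)) = e i := by
      intro i
      rw [map_smul]
      change (ν i)⁻¹ • T (e i) = e i
      rw [hTe, smul_smul, inv_mul_cancel₀ (hνpos i).ne', one_smul]
    refine ⟨fun i => (ν i)⁻¹ • K (e i), ?_, fun i => ⟨(ν i)⁻¹, ?_, fun v => ?_⟩⟩
    · convert he using 1
      funext i; exact hJu i
    · exact inv_le_of_inv_le₀ hc (hν i)
    · rw [hJu, map_smul, _root_.smul_apply, hK]; rfl
  · exfalso
    obtain ⟨f, hf, hf0, hle⟩ := h _ hw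
    obtain ⟨v, hv, rfl⟩ : ∃ v ∈ Submodule.span ℝ (Set.range w), J v = f := by
      rw [Set.range_comp] at hf
      have := Submodule.map_span (J : H →ₗ[ℝ] X) (Set.range w)
      rw [ContinuousLinearMap.coe_coe] at this
      rw [← this] at hf
      exact hf
    have h1 := hlt v hv hf0
    -- Completing the square: the expansion is `c² ⟨T J v, J v⟩ - 2c ‖J v‖² + B v v`. The Rayleigh
    -- bound for `T` then gives `B v v ≥ c ‖J v‖²`, contrary to `hlt`.
    have h2 : 0 ≤ B (c • K (J v) - v) (c • K (J v) - v) := by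
      obtain ⟨C, hC, hco⟩ := hB
      exact le_trans (by positivity) (hco _)
    have h3 : B (K (J v)) (K (J v)) = inner ℝ (T (J v)) (J v) := (hTin _ _).symm
    have h4 : B (K (J v)) v = ‖J v‖ ^ 2 := by rw [hK, real_inner_self_eq_norm_sq]
    have h5 : B v (K (J v)) = ‖J v‖ ^ 2 := by rw [hsymm, h4]
    simp only [map_sub, map_smul, _root_.sub_apply, _root_.smul_apply,
      smul_eq_mul, h3, h4, h5] at h2
    have h6 : c * (c * inner ℝ (T (J v)) (J v)) ≤ c * ‖J v‖ ^ 2 := by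
      have := mul_le_mul_of_nonneg_left hle (mul_nonneg hc.le hc.le)
      calc _ = c * c * inner ℝ (T (J v)) (J v) := by ring
        _ ≤ _ := this
        _ = _ := by field_simp
    linarith

end Spectral

/-! ### Rellich compactness by finite-rank local averaging. -/

section Rellich

theorem sq_lintegral_le {α : Type*} [MeasurableSpace α] (μ : Measure α) {f : α → ℝ≥0∞}
    (hf : AEMeasurable f μ) : (∫⁻ x, f x ∂μ) ^ 2 ≤ μ Set.univ * ∫⁻ x, f x ^ 2 ∂μ := by
  have h := ENNReal.lintegral_mul_le_Lp_mul_Lq μ Real.HolderConjugate.two_two hf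
    (aemeasurable_const (b := (1 : ℝ≥0∞)))
  simp only [Pi.mul_apply, mul_one, ENNReal.one_rpow, lintegral_const, one_mul] at h
  have h2 := pow_le_pow_left' h 2
  rw [mul_pow, ← ENNReal.rpow_natCast, ← ENNReal.rpow_natCast, ← ENNReal.rpow_mul,
    ← ENNReal.rpow_natCast, ← ENNReal.rpow_mul] at h2
  norm_num at h2
  rw [mul_comm]
  exact_mod_cast h2

variable {d : ℕ}

theorem continuous_gradient {φ : E d → ℝ} (hφ : ContDiff ℝ 1 φ) : Continuous (∇ φ) := by
  unfold gradient
  exact (LinearIsometryEquiv.continuous _).comp (hφ.continuous_fderiv one_ne_zero)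

/-- Translations are `L²`-Lipschitz on functions with square integrable gradient. -/
theorem lintegral_translate_sub_sq_le {φ : E d → ℝ} (hφ : ContDiff ℝ 1 φ) (z : E d) :
    ∫⁻ x, ‖φ (x + z) - φ x‖ₑ ^ 2 ≤ ‖z‖ₑ ^ 2 * ∫⁻ x, ‖∇ φ x‖ₑ ^ 2 := by
  have hg := continuous_gradient hφ
  have hpt : ∀ x, ‖φ (x + z) - φ x‖ₑ ^ 2 ≤
      ‖z‖ₑ ^ 2 * ∫⁻ s in Set.Ioc (0 : ℝ) 1, ‖∇ φ (x + s • z)‖ₑ ^ 2 := by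
    intro x
    have hd : ∀ s : ℝ, HasDerivAt (fun s : ℝ => φ (x + s • z)) (inner ℝ (∇ φ (x + s • z)) z) s := by
      intro s
      have h1 : HasGradientAt φ (∇ φ (x + s • z)) (x + s • z) :=
        (hφ.differentiable one_ne_zero _).hasGradientAt
      have h2 : HasDerivAt (fun s : ℝ => x + s • z) z s := by
        simpa using ((hasDerivAt_id s).smul_const z).const_add x
      have := (hasGradientAt_iff_hasFDerivAt.1 h1).comp_hasDerivAt s h2
      simpa using! this
    have hint : φ (x + z) - φ x = ∫ s in (0 : ℝ)..1, inner ℝ (∇ φ (x + s • z)) z := by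
      rw [intervalIntegral.integral_eq_sub_of_hasDerivAt (fun s _ => hd s)]
      · simp
      · exact Continuous.intervalIntegrable (by fun_prop) _ _
    rw [hint, intervalIntegral.integral_of_le zero_le_one]
    have h1 : ‖∫ s in Set.Ioc (0 : ℝ) 1, inner ℝ (∇ φ (x + s • z)) z‖ₑ ≤
        ∫⁻ s in Set.Ioc (0 : ℝ) 1, ‖∇ φ (x + s • z)‖ₑ * ‖z‖ₑ := by
      refine (enorm_integral_le_lintegral_enorm _).trans (lintegral_mono fun s => ?_)
      rw [← ofReal_norm, ← ofReal_norm, ← ofReal_norm, ← ENNReal.ofReal_mul (norm_nonneg _)]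
      exact ENNReal.ofReal_le_ofReal (norm_inner_le_norm _ _)
    have hmeas : Measurable fun s : ℝ => ‖∇ φ (x + s • z)‖ₑ :=
      (Continuous.enorm (by fun_prop)).measurable
    rw [lintegral_mul_const _ hmeas] at h1
    refine (pow_le_pow_left' h1 2).trans ?_
    rw [mul_pow, mul_comm]
    gcongr
    refine (sq_lintegral_le _ hmeas.aemeasurable).trans ?_
    simp
  calc ∫⁻ x, ‖φ (x + z) - φ x‖ₑ ^ 2
      ≤ ∫⁻ x, ‖z‖ₑ ^ 2 * ∫⁻ s in Set.Ioc (0 : ℝ) 1, ‖∇ φ (x + s • z)‖ₑ ^ 2 := lintegral_mono hpt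
    _ = ‖z‖ₑ ^ 2 * ∫⁻ x, ∫⁻ s in Set.Ioc (0 : ℝ) 1, ‖∇ φ (x + s • z)‖ₑ ^ 2 :=
        lintegral_const_mul' _ _ (by simp)
    _ = ‖z‖ₑ ^ 2 * ∫⁻ s in Set.Ioc (0 : ℝ) 1, ∫⁻ x, ‖∇ φ (x + s • z)‖ₑ ^ 2 := by
        rw [lintegral_lintegral_swap]
        refine Measurable.aemeasurable ?_
        have : Continuous fun p : E d × ℝ => ∇ φ (p.1 + p.2 • z) := by fun_prop
        exact this.enorm.measurable.pow_const 2
    _ = ‖z‖ₑ ^ 2 * ∫⁻ x, ‖∇ φ x‖ₑ ^ 2 := by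
        congr 1
        have : ∀ s : ℝ, ∫⁻ x, ‖∇ φ (x + s • z)‖ₑ ^ 2 = ∫⁻ x, ‖∇ φ x‖ₑ ^ 2 := fun s =>
          lintegral_add_right_eq_self (fun x => ‖∇ φ x‖ₑ ^ 2) (s • z)
        simp [this]

/-- Local averages over balls of radius `h` with centers `c x` near `x` approximate `φ`. -/
theorem lintegral_sub_average_sq_le {φ : E d → ℝ} (hφ : ContDiff ℝ 1 φ)
    {U : Set (E d)} {h : ℝ} (hh : 0 < h) {c : E d → E d}
    (hc : ∀ x ∈ U, dist (c x) x < h) (hU : MeasurableSet U) :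
    ∫⁻ x in U, ‖φ x - (volume.real (Metric.ball (0 : E d) h))⁻¹ *
        ∫ y in Metric.ball (c x) h, φ y‖ₑ ^ 2 ≤
      2 ^ d * ENNReal.ofReal (2 * h) ^ 2 * ∫⁻ x, ‖∇ φ x‖ₑ ^ 2 := by
  set b : ℝ≥0∞ := volume (Metric.ball (0 : E d) h) with hb
  have hb0 : b ≠ 0 := (Metric.measure_ball_pos _ _ hh).ne'
  have hbt : b ≠ ∞ := measure_ball_lt_top.ne
  have hbr : volume.real (Metric.ball (0 : E d) h) = b.toReal := rfl
  have hball : ∀ p : E d, volume (Metric.ball p h) = b := fun p =>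
    Measure.addHaar_ball_center volume p h
  -- Cauchy–Schwarz on the averaging ball, then enlargement to the ball of radius `2h` about `x`.
  -- After this the shifts `z` range over a set independent of `x`, at the price of the volume ratio
  -- `2 ^ d`.
  have hpt : ∀ x ∈ U, ‖φ x - b.toReal⁻¹ * ∫ y in Metric.ball (c x) h, φ y‖ₑ ^ 2 ≤
      b⁻¹ * ∫⁻ z in Metric.ball (0 : E d) (2 * h), ‖φ (x + z) - φ x‖ₑ ^ 2 := by
    intro x hx
    have hint : IntegrableOn φ (Metric.ball (c x) h) :=
      (hφ.continuous.locallyIntegrable.integrableOn_isCompact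
        (isCompact_closedBall (c x) h)).mono_set Metric.ball_subset_closedBall
    have h1 : φ x - b.toReal⁻¹ * ∫ y in Metric.ball (c x) h, φ y =
        b.toReal⁻¹ * ∫ y in Metric.ball (c x) h, (φ x - φ y) := by
      rw [integral_sub (integrableOn_const (C := φ x) measure_ball_lt_top.ne (by simp)) hint]
      simp only [integral_const, MeasurableSet.univ, measureReal_restrict_apply, Set.univ_inter,
        smul_eq_mul]
      rw [show volume.real (Metric.ball (c x) h) = b.toReal by rw [Measure.real, hball]]
      have : b.toReal ≠ 0 := (ENNReal.toReal_pos hb0 hbt).ne'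
      field_simp
    rw [h1, enorm_mul, mul_pow]
    have h2 : ‖b.toReal⁻¹‖ₑ = b⁻¹ := by
      rw [enorm_inv (ENNReal.toReal_pos hb0 hbt).ne', ← ofReal_norm, Real.norm_of_nonneg
        ENNReal.toReal_nonneg, ENNReal.ofReal_toReal hbt]
    have hmeas : Measurable fun y => ‖φ x - φ y‖ₑ :=
      (continuous_const.sub hφ.continuous).enorm.measurable
    have h3 : ‖∫ y in Metric.ball (c x) h, (φ x - φ y)‖ₑ ^ 2 ≤
        b * ∫⁻ y in Metric.ball (c x) h, ‖φ x - φ y‖ₑ ^ 2 := by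
      refine (pow_le_pow_left' (enorm_integral_le_lintegral_enorm _) 2).trans ?_
      refine (sq_lintegral_le _ hmeas.aemeasurable).trans ?_
      rw [Measure.restrict_apply_univ, hball]
    have h4 : ∫⁻ y in Metric.ball (c x) h, ‖φ x - φ y‖ₑ ^ 2 ≤
        ∫⁻ z in Metric.ball (0 : E d) (2 * h), ‖φ (x + z) - φ x‖ₑ ^ 2 := by
      calc ∫⁻ y in Metric.ball (c x) h, ‖φ x - φ y‖ₑ ^ 2
          ≤ ∫⁻ y in Metric.ball x (2 * h), ‖φ x - φ y‖ₑ ^ 2 := by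
            refine lintegral_mono_set (Metric.ball_subset_ball' ?_)
            have := hc x hx
            linarith
        _ = ∫⁻ y, (Metric.ball x (2 * h)).indicator (fun y => ‖φ x - φ y‖ₑ ^ 2) y := by
            rw [lintegral_indicator measurableSet_ball]
        _ = ∫⁻ z, (Metric.ball x (2 * h)).indicator (fun y => ‖φ x - φ y‖ₑ ^ 2) (x + z) :=
            (lintegral_add_left_eq_self _ x).symm
        _ = ∫⁻ z in Metric.ball (0 : E d) (2 * h), ‖φ (x + z) - φ x‖ₑ ^ 2 := by
            rw [← lintegral_indicator measurableSet_ball]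
            refine lintegral_congr fun z => ?_
            by_cases hz : z ∈ Metric.ball (0 : E d) (2 * h)
            · have hz' : x + z ∈ Metric.ball x (2 * h) := by simpa using hz
              rw [Set.indicator_of_mem hz, Set.indicator_of_mem hz', enorm_sub_rev]
            · have hz' : x + z ∉ Metric.ball x (2 * h) := by simpa using hz
              rw [Set.indicator_of_notMem hz, Set.indicator_of_notMem hz']
    calc ‖b.toReal⁻¹‖ₑ ^ 2 * ‖∫ y in Metric.ball (c x) h, (φ x - φ y)‖ₑ ^ 2
        ≤ b⁻¹ ^ 2 * (b * ∫⁻ z in Metric.ball (0 : E d) (2 * h), ‖φ (x + z) - φ x‖ₑ ^ 2) := by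
          rw [h2]
          exact mul_le_mul_right (h3.trans (mul_le_mul_right h4 _)) _
      _ = b⁻¹ * ∫⁻ z in Metric.ball (0 : E d) (2 * h), ‖φ (x + z) - φ x‖ₑ ^ 2 := by
          rw [← mul_assoc, sq, mul_assoc b⁻¹, ENNReal.inv_mul_cancel hb0 hbt, mul_one]
  rw [hbr]
  calc ∫⁻ x in U, ‖φ x - b.toReal⁻¹ * ∫ y in Metric.ball (c x) h, φ y‖ₑ ^ 2
      ≤ ∫⁻ x in U, b⁻¹ * ∫⁻ z in Metric.ball (0 : E d) (2 * h), ‖φ (x + z) - φ x‖ₑ ^ 2 :=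
        setLIntegral_mono' hU hpt
    _ ≤ ∫⁻ x, b⁻¹ * ∫⁻ z in Metric.ball (0 : E d) (2 * h), ‖φ (x + z) - φ x‖ₑ ^ 2 :=
        setLIntegral_le_lintegral _ _
    _ = b⁻¹ * ∫⁻ z in Metric.ball (0 : E d) (2 * h), ∫⁻ x, ‖φ (x + z) - φ x‖ₑ ^ 2 := by
        rw [lintegral_const_mul' _ _ (ENNReal.inv_ne_top.2 hb0), lintegral_lintegral_swap]
        refine Measurable.aemeasurable ?_
        have : Continuous fun p : E d × E d => φ (p.1 + p.2) - φ p.1 :=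
          (hφ.continuous.comp (by fun_prop)).sub (hφ.continuous.comp (by fun_prop))
        exact this.enorm.measurable.pow_const 2
    _ ≤ b⁻¹ * ∫⁻ z in Metric.ball (0 : E d) (2 * h),
          ENNReal.ofReal (2 * h) ^ 2 * ∫⁻ x, ‖∇ φ x‖ₑ ^ 2 := by
        refine mul_le_mul_right (setLIntegral_mono' measurableSet_ball fun z hz => ?_) _
        refine (lintegral_translate_sub_sq_le hφ z).trans ?_
        gcongr
        rw [← ofReal_norm]
        exact ENNReal.ofReal_le_ofReal (mem_ball_zero_iff.1 hz).le
    _ = 2 ^ d * ENNReal.ofReal (2 * h) ^ 2 * ∫⁻ x, ‖∇ φ x‖ₑ ^ 2 := by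
        rw [setLIntegral_const, Measure.addHaar_ball_mul_of_pos volume (0 : E d) two_pos h, ← hb]
        rw [finrank_euclideanSpace, Fintype.card_fin, ENNReal.ofReal_pow zero_le_two,
          ENNReal.ofReal_ofNat]
        calc _ = 2 ^ d * ENNReal.ofReal (2 * h) ^ 2 * (∫⁻ x, ‖∇ φ x‖ₑ ^ 2) * (b * b⁻¹) := by ring
          _ = _ := by rw [ENNReal.mul_inv_cancel hb0 hbt, mul_one]

theorem isCompactOperator_smulRight {X : Type*} [NormedAddCommGroup X] [NormedSpace ℝ X]
    (l : X →L[ℝ] ℝ) (x : X) : IsCompactOperator (l.smulRight x) := by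
  have : IsCompactOperator (ContinuousLinearMap.toSpanSingleton ℝ x) :=
    isCompactOperator_of_locallyCompactSpace_rng _
  have h := this.comp_clm l
  exact h

theorem isCompactOperator_sum {X ι : Type*} [NormedAddCommGroup X] [NormedSpace ℝ X]
    (s : Finset ι) (T : ι → X →L[ℝ] X) (h : ∀ i ∈ s, IsCompactOperator (T i)) :
    IsCompactOperator (∑ i ∈ s, T i : X →L[ℝ] X) := by
  classical
  induction s using Finset.induction_on with
  | empty => simpa using isCompactOperator_zero
  | insert a s ha ih =>
    rw [Finset.sum_insert ha]
    exact (h a (Finset.mem_insert_self _ _)).add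
      (ih fun i hi => h i (Finset.mem_insert_of_mem hi))

theorem norm_sq_eq_lintegral {F : Type*} [NormedAddCommGroup F] (f : Lp F 2 (volume : Measure (E d)))
    {g : E d → F} (hfg : f =ᵐ[volume] g) : ENNReal.ofReal (‖f‖ ^ 2) = ∫⁻ x, ‖g x‖ₑ ^ 2 := by
  rw [Lp.norm_def, ← ENNReal.toReal_pow, ENNReal.ofReal_toReal
    (ENNReal.pow_ne_top (Lp.eLpNorm_ne_top f)), eLpNorm_congr_ae hfg,
    eLpNorm_eq_lintegral_rpow_enorm_toReal two_ne_zero ENNReal.ofNat_ne_top]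
  rw [← ENNReal.rpow_natCast, ← ENNReal.rpow_mul]
  simp

/-- The embedding of `H¹₀(U)` in `L²` is a limit of compact operators. -/
theorem exists_compact_approx {U : Set (E d)} (hUb : Bornology.IsBounded U)
    (hU : MeasurableSet U) {η : ℝ} (hη : 0 < η) :
    ∃ T : L2 d →L[ℝ] L2 d, IsCompactOperator T ∧
      ∀ p ∈ sobolevGraph U, ‖p.1 - T p.1‖ ≤ η * ‖p.2‖ := by
  classical
  -- Chosen so that `2 ^ d * (2 * h) = η`, which dominates the constant of the averaging estimate.
  set h : ℝ := η / 2 ^ (d + 1) with hh_def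
  have hh : 0 < h := by positivity
  -- By compactness finitely many dense points suffice as centers of averaging. The nearest-point
  -- map is then a simple function, which makes the averaging operator `T` finite rank.
  obtain ⟨N, hN⟩ : ∃ N : ℕ, ∀ x ∈ U,
      dist (SimpleFunc.nearestPt (TopologicalSpace.denseSeq (E d)) N x) x < h := by
    have hK : IsCompact (closure U) := hUb.isCompact_closure
    obtain ⟨t, ht⟩ := hK.elim_finite_subcover
      (fun i : ℕ => Metric.ball (TopologicalSpace.denseSeq (E d) i) h)
      (fun i => Metric.isOpen_ball) (fun x _ => by
        obtain ⟨i, hi⟩ := (TopologicalSpace.denseRange_denseSeq (E d)).exists_dist_lt x hh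
        exact Set.mem_iUnion.2 ⟨i, hi⟩)
    refine ⟨t.sup id, fun x hx => ?_⟩
    obtain ⟨i, hi, hxi⟩ := Set.mem_iUnion₂.1 (ht (subset_closure hx))
    have h1 := SimpleFunc.edist_nearestPt_le (TopologicalSpace.denseSeq (E d)) x
      (Finset.le_sup (f := id) hi)
    have h2 : edist (TopologicalSpace.denseSeq (E d) i) x < ENNReal.ofReal h := by
      rw [edist_dist, ENNReal.ofReal_lt_ofReal_iff hh, dist_comm]; exact hxi
    have h3 := h1.trans_lt h2
    rwa [edist_dist, ENNReal.ofReal_lt_ofReal_iff hh] at h3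
  set c : SimpleFunc (E d) (E d) := SimpleFunc.nearestPt (TopologicalSpace.denseSeq (E d)) N
  set b : ℝ := volume.real (Metric.ball (0 : E d) h) with hb
  have hUp : ∀ p : E d, MeasurableSet (U ∩ c ⁻¹' {p}) := fun p =>
    hU.inter (c.measurableSet_fiber p)
  have hUf : ∀ p : E d, volume (U ∩ c ⁻¹' {p}) ≠ ∞ := fun p =>
    ((measure_mono Set.inter_subset_left).trans_lt hUb.measure_lt_top).ne
  let e : E d → L2 d := fun p => indicatorConstLp 2 (hUp p) (hUf p) (1 : ℝ)
  let a : E d → L2 d := fun p => indicatorConstLp 2 (measurableSet_ball (x := p) (ε := h))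
    measure_ball_lt_top.ne (1 : ℝ)
  let T : L2 d →L[ℝ] L2 d := ∑ p ∈ c.range, (b⁻¹ • innerSL ℝ (a p)).smulRight (e p)
  refine ⟨T, isCompactOperator_sum _ _ fun p _ => isCompactOperator_smulRight _ _, ?_⟩
  have hclosed : IsClosed {p : L2 d × L2Vec d | ‖p.1 - T p.1‖ ≤ η * ‖p.2‖} :=
    isClosed_le (by fun_prop) (by fun_prop)
  refine fun p hp => closure_minimal ?_ hclosed hp
  rintro ⟨u, g⟩ ⟨φ, hφ, hu, hg⟩
  change ‖u - T u‖ ≤ η * ‖g‖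
  simp only at hu hg
  have hφ1 : ContDiff ℝ 1 φ := hφ.smooth.of_le (by exact_mod_cast le_top)
  have hTu : (T u : E d → ℝ) =ᵐ[volume] U.indicator fun x => b⁻¹ *
      ∫ y in Metric.ball (c x) h, φ y := by
    have hT1 : T u = ∑ p ∈ c.range, (b⁻¹ * ∫ y in Metric.ball p h, φ y) • e p := by
      simp only [T, _root_.sum_apply, ContinuousLinearMap.smulRight_apply]
      refine Finset.sum_congr rfl fun p _ => ?_
      congr 1
      change b⁻¹ • inner ℝ (a p) u = _
      rw [L2.inner_indicatorConstLp_one, smul_eq_mul]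
      congr 1
      exact integral_congr_ae (ae_restrict_of_ae hu)
    have hco : ∀ᵐ x, ∀ p ∈ c.range, (((b⁻¹ * ∫ y in Metric.ball p h, φ y) • e p : L2 d) : E d → ℝ) x
        = (U ∩ c ⁻¹' {p}).indicator (fun _ => b⁻¹ * ∫ y in Metric.ball p h, φ y) x := by
      rw [Filter.eventually_all_finset]
      intro p _
      filter_upwards [Lp.coeFn_smul (b⁻¹ * ∫ y in Metric.ball p h, φ y) (e p),
        indicatorConstLp_coeFn (p := 2) (hs := hUp p) (hμs := hUf p) (c := (1 : ℝ))] with x h1 h2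
      rw [h1, Pi.smul_apply]
      change _ • (indicatorConstLp 2 (hUp p) (hUf p) (1 : ℝ) : E d → ℝ) x = _
      rw [h2]
      simp [Set.indicator_apply]
    have hs : ((∑ p ∈ c.range, (b⁻¹ * ∫ y in Metric.ball p h, φ y) • e p : L2 d) : E d → ℝ) =ᵐ[volume]
        fun x => ∑ p ∈ c.range, (((b⁻¹ * ∫ y in Metric.ball p h, φ y) • e p : L2 d) : E d → ℝ) x := by
      filter_upwards [Lp.coeFn_finsetSum c.range
        (fun p => (b⁻¹ * ∫ y in Metric.ball p h, φ y) • e p)] with x hx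
      rw [hx, Finset.sum_apply]
    rw [hT1]
    filter_upwards [hs, hco] with x h1 h2
    rw [h1, Finset.sum_congr rfl h2]
    by_cases hx : x ∈ U
    · rw [Finset.sum_eq_single (c x)]
      · simp [hx]
      · intro p _ hpx
        rw [Set.indicator_of_notMem]
        exact fun hmem => hpx hmem.2.symm
      · exact fun hmem => (hmem (c.mem_range_self x)).elim
    · simp [hx]
  have hdiff : ((u - T u : L2 d) : E d → ℝ) =ᵐ[volume] U.indicator fun x => φ x - b⁻¹ *
      ∫ y in Metric.ball (c x) h, φ y := by
    filter_upwards [Lp.coeFn_sub u (T u), hu, hTu] with x h1 h2 h3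
    rw [h1, Pi.sub_apply, h2, h3]
    by_cases hx : x ∈ U
    · simp [hx]
    · have : φ x = 0 := image_eq_zero_of_notMem_tsupport fun hmem => hx (hφ.tsupport_subset hmem)
      simp [hx, this]
  have h1 : ENNReal.ofReal (‖u - T u‖ ^ 2) ≤ ENNReal.ofReal ((η * ‖g‖) ^ 2) := by
    rw [norm_sq_eq_lintegral _ hdiff]
    have h2 : ∀ x, ‖U.indicator (fun x => φ x - b⁻¹ * ∫ y in Metric.ball (c x) h, φ y) x‖ₑ ^ 2 =
        U.indicator (fun x => ‖φ x - b⁻¹ * ∫ y in Metric.ball (c x) h, φ y‖ₑ ^ 2) x := by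
      intro x
      by_cases hx : x ∈ U <;> simp [hx]
    rw [lintegral_congr h2, lintegral_indicator hU]
    refine (lintegral_sub_average_sq_le hφ1 hh hN hU).trans ?_
    rw [← norm_sq_eq_lintegral _ hg, mul_pow, ENNReal.ofReal_mul (sq_nonneg _)]
    refine mul_le_mul_left ?_ _
    rw [← ENNReal.ofReal_pow (by positivity), ← ENNReal.ofReal_ofNat 2,
      ← ENNReal.ofReal_pow (by norm_num), ← ENNReal.ofReal_mul (by positivity)]
    refine ENNReal.ofReal_le_ofReal ?_
    have h3 : η = 2 ^ d * (2 * h) := by rw [hh_def]; field_simp; ring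
    have h4 : η ^ 2 = (2 ^ d) ^ 2 * (2 * h) ^ 2 := by rw [← mul_pow, ← h3]
    rw [h4]
    exact mul_le_mul_of_nonneg_right (le_self_pow₀ (one_le_pow₀ one_le_two) two_ne_zero)
      (sq_nonneg _)
  rw [ENNReal.ofReal_le_ofReal_iff (sq_nonneg _)] at h1
  exact (sq_le_sq₀ (norm_nonneg _) (by positivity)).1 h1

end Rellich

/-! ### The Hilbert space `H¹₀(U)` and its energy form. -/

section Form

variable {d : ℕ} {U : Set (E d)} {φ ψ : E d → ℝ}

theorem gradient_add' (hφ : ContDiff ℝ 1 φ) (hψ : ContDiff ℝ 1 ψ) :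
    ∇ (φ + ψ) = ∇ φ + ∇ ψ := by
  funext x
  simp only [gradient, Pi.add_apply]
  rw [fderiv_add (hφ.differentiable one_ne_zero _) (hψ.differentiable one_ne_zero _), map_add]

theorem gradient_smul' (hφ : ContDiff ℝ 1 φ) (c : ℝ) : ∇ (c • φ) = c • ∇ φ := by
  funext x
  simp only [gradient, Pi.smul_apply]
  rw [fderiv_const_smul (hφ.differentiable one_ne_zero _), map_smulₛₗ]
  rfl

theorem tsupport_gradient_subset : tsupport (∇ φ) ⊆ tsupport φ := by
  refine (closure_mono fun x hx => ?_).trans (tsupport_fderiv_subset (𝕜 := ℝ) (f := φ))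
  contrapose! hx
  rw [Function.notMem_support] at hx ⊢
  simp [gradient, hx]

namespace IsTestFunction

theorem contDiff_one (hφ : IsTestFunction U φ) : ContDiff ℝ 1 φ :=
  hφ.smooth.of_le (by exact_mod_cast le_top)

theorem memLp (hφ : IsTestFunction U φ) : MemLp φ 2 (volume : Measure (E d)) :=
  hφ.smooth.continuous.memLp_of_hasCompactSupport hφ.hasCompactSupport

theorem memLp_gradient (hφ : IsTestFunction U φ) : MemLp (∇ φ) 2 (volume : Measure (E d)) :=
  (continuous_gradient hφ.contDiff_one).memLp_of_hasCompactSupport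
    (hφ.hasCompactSupport.mono' ((subset_tsupport _).trans tsupport_gradient_subset))

theorem zero : IsTestFunction U (0 : E d → ℝ) where
  smooth := contDiff_const
  hasCompactSupport := HasCompactSupport.zero
  tsupport_subset := by simp [tsupport]

theorem add (hφ : IsTestFunction U φ) (hψ : IsTestFunction U ψ) : IsTestFunction U (φ + ψ) where
  smooth := hφ.smooth.add hψ.smooth
  hasCompactSupport := hφ.hasCompactSupport.add hψ.hasCompactSupport
  tsupport_subset := (tsupport_add φ ψ).trans (Set.union_subset hφ.tsupport_subset hψ.tsupport_subset)

theorem smul (hφ : IsTestFunction U φ) (c : ℝ) : IsTestFunction U (c • φ) where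
  smooth := hφ.smooth.const_smul c
  hasCompactSupport := hφ.hasCompactSupport.smul_left (f := fun _ => c)
  tsupport_subset := (tsupport_smul_subset_right (fun _ => c) φ).trans hφ.tsupport_subset

theorem mono {U' : Set (E d)} (hφ : IsTestFunction U φ) (h : U ⊆ U') : IsTestFunction U' φ where
  smooth := hφ.smooth
  hasCompactSupport := hφ.hasCompactSupport
  tsupport_subset := hφ.tsupport_subset.trans h

theorem eq_zero (hφ : IsTestFunction U φ) {x : E d} (hx : x ∉ U) : φ x = 0 :=
  image_eq_zero_of_notMem_tsupport fun h => hx (hφ.tsupport_subset h)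

end IsTestFunction

/-- The pairs `(φ, ∇φ)` form a subspace. -/
noncomputable def testSubmodule (U : Set (E d)) : Submodule ℝ (L2 d × L2Vec d) where
  carrier := testGraph U
  zero_mem' := by
    refine ⟨0, IsTestFunction.zero, Lp.coeFn_zero _ _ _, ?_⟩
    have : ∇ (0 : E d → ℝ) = 0 := by funext x; simp [gradient]
    rw [this]
    exact Lp.coeFn_zero _ _ _
  add_mem' := by
    rintro p q ⟨φ, hφ, h1, h2⟩ ⟨ψ, hψ, h3, h4⟩
    refine ⟨φ + ψ, hφ.add hψ, (Lp.coeFn_add _ _).trans (h1.add h3), ?_⟩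
    rw [gradient_add' hφ.contDiff_one hψ.contDiff_one]
    exact (Lp.coeFn_add _ _).trans (h2.add h4)
  smul_mem' := by
    rintro c p ⟨φ, hφ, h1, h2⟩
    refine ⟨c • φ, hφ.smul c, (Lp.coeFn_smul _ _).trans (h1.const_smul c), ?_⟩
    rw [gradient_smul' hφ.contDiff_one]
    exact (Lp.coeFn_smul _ _).trans (h2.const_smul c)

/-- `H¹₀(U)` as a subspace of the Hilbert space `L² × L²`. -/
noncomputable def sobolevSubmodule (U : Set (E d)) : Submodule ℝ (WithLp 2 (L2 d × L2Vec d)) :=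
  (testSubmodule U).topologicalClosure.comap
    (WithLp.prodContinuousLinearEquiv 2 ℝ (L2 d) (L2Vec d) :
      WithLp 2 (L2 d × L2Vec d) →ₗ[ℝ] L2 d × L2Vec d)

instance : CompleteSpace (sobolevSubmodule U) := by
  have : IsClosed (sobolevSubmodule U : Set (WithLp 2 (L2 d × L2Vec d))) :=
    (testSubmodule U).isClosed_topologicalClosure.preimage
      (WithLp.prodContinuousLinearEquiv 2 ℝ (L2 d) (L2Vec d)).continuous
  exact this.completeSpace_coe

/-- The embedding `H¹₀(U) → L²`. -/
noncomputable def sobolevVal (U : Set (E d)) : sobolevSubmodule U →L[ℝ] L2 d :=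
  (WithLp.fstL 2 ℝ (L2 d) (L2Vec d)).comp (sobolevSubmodule U).subtypeL

/-- The weak gradient `H¹₀(U) → L²`. -/
noncomputable def sobolevGrad (U : Set (E d)) : sobolevSubmodule U →L[ℝ] L2Vec d :=
  (WithLp.sndL 2 ℝ (L2 d) (L2Vec d)).comp (sobolevSubmodule U).subtypeL

theorem sobolev_mem (x : sobolevSubmodule U) : (sobolevVal U x, sobolevGrad U x) ∈ sobolevGraph U :=
  x.2

theorem sobolev_norm_sq (x : sobolevSubmodule U) :
    ‖x‖ ^ 2 = ‖sobolevVal U x‖ ^ 2 + ‖sobolevGrad U x‖ ^ 2 :=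
  WithLp.prod_norm_sq_eq_of_L2 _

theorem exists_sobolev {p : L2 d × L2Vec d} (hp : p ∈ sobolevGraph U) :
    ∃ x : sobolevSubmodule U, sobolevVal U x = p.1 ∧ sobolevGrad U x = p.2 :=
  ⟨⟨WithLp.toLp 2 p, hp⟩, rfl, rfl⟩

/-- Rellich's theorem for `H¹₀(U)`, `U` bounded. -/
theorem isCompactOperator_sobolevVal (hUb : Bornology.IsBounded U) (hU : MeasurableSet U) :
    IsCompactOperator (sobolevVal U) := by
  have hpos : ∀ n : ℕ, (0 : ℝ) < 1 / ((n : ℝ) + 1) := fun n => Nat.one_div_pos_of_nat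
  choose T hTc hT using fun n : ℕ => exists_compact_approx hUb hU (hpos n)
  refine isCompactOperator_of_tendsto (l := atTop) (F := fun n => (T n).comp (sobolevVal U)) ?_
    (Eventually.of_forall fun n => (hTc n).comp_clm _)
  refine (tendsto_iff_norm_sub_tendsto_zero (E := sobolevSubmodule U →L[ℝ] L2 d)).2 ?_
  refine squeeze_zero (fun _ => ContinuousLinearMap.opNorm_nonneg _) (fun n => ?_)
    tendsto_one_div_add_atTop_nhds_zero_nat
  refine ContinuousLinearMap.opNorm_le_bound _ (hpos n).le fun x => ?_
  have h1 := hT n _ (sobolev_mem x)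
  have h2 : ‖sobolevGrad U x‖ ≤ ‖x‖ := by
    have := sobolev_norm_sq x
    refine (sq_le_sq₀ (norm_nonneg _) (norm_nonneg _)).1 ?_
    nlinarith [sq_nonneg ‖sobolevVal U x‖]
  rw [norm_sub_rev] at h1
  exact h1.trans (mul_le_mul_of_nonneg_left h2 (hpos n).le)

/-- A test function as an element of `H¹₀(U)`. -/
noncomputable def IsTestFunction.toSobolev (hφ : IsTestFunction U φ) : sobolevSubmodule U :=
  ⟨WithLp.toLp 2 (hφ.memLp.toLp φ, hφ.memLp_gradient.toLp (∇ φ)),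
    subset_closure ⟨φ, hφ, hφ.memLp.coeFn_toLp, hφ.memLp_gradient.coeFn_toLp⟩⟩

theorem IsTestFunction.coeFn_val (hφ : IsTestFunction U φ) :
    (sobolevVal U hφ.toSobolev : E d → ℝ) =ᵐ[volume] φ := hφ.memLp.coeFn_toLp

theorem IsTestFunction.coeFn_grad (hφ : IsTestFunction U φ) :
    (sobolevGrad U hφ.toSobolev : E d → E d) =ᵐ[volume] ∇ φ := hφ.memLp_gradient.coeFn_toLp

/-- Two continuous functionals that agree on test functions agree on `H¹₀(U)`. -/
theorem sobolev_ext {l m : sobolevSubmodule U →L[ℝ] ℝ}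
    (h : ∀ (φ : E d → ℝ) (hφ : IsTestFunction U φ), l hφ.toSobolev = m hφ.toSobolev) : l = m := by
  ext x
  let e := WithLp.prodContinuousLinearEquiv 2 ℝ (L2 d) (L2Vec d)
  have hcl : x ∈ closure {y : sobolevSubmodule U |
      ∃ (φ : E d → ℝ) (hφ : IsTestFunction U φ), hφ.toSobolev = y} := by
    rw [Topology.IsEmbedding.subtypeVal.closure_eq_preimage_closure_image, Set.mem_preimage]
    have h1 : (x : WithLp 2 (L2 d × L2Vec d)) ∈ e ⁻¹' closure (testGraph U) := x.2
    rw [e.preimage_closure] at h1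
    refine closure_mono ?_ h1
    rintro y ⟨φ, hφ, h2, h3⟩
    refine ⟨hφ.toSobolev, ⟨φ, hφ, rfl⟩, ?_⟩
    refine (WithLp.equiv 2 (L2 d × L2Vec d)).injective (Prod.ext ?_ ?_)
    · exact Lp.ext (hφ.memLp.coeFn_toLp.trans h2.symm)
    · exact Lp.ext (hφ.memLp_gradient.coeFn_toLp.trans h3.symm)
  have hclosed : IsClosed {y : sobolevSubmodule U | l y = m y} :=
    isClosed_eq l.continuous m.continuous
  refine closure_minimal ?_ hclosed hcl
  rintro y ⟨φ, hφ, rfl⟩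
  exact h φ hφ

/-- The form `½⟨∇u, ∇v⟩ + ⟨m u, v⟩` on `H¹₀(U)`. -/
noncomputable def energyForm (U : Set (E d)) (m : L2 d →L[ℝ] L2 d) :
    sobolevSubmodule U →L[ℝ] sobolevSubmodule U →L[ℝ] ℝ :=
  (1 / 2 : ℝ) • ContinuousLinearMap.bilinearComp (innerSL ℝ : L2Vec d →L[ℝ] L2Vec d →L[ℝ] ℝ)
      (sobolevGrad U) (sobolevGrad U) +
    ContinuousLinearMap.bilinearComp (innerSL ℝ : L2 d →L[ℝ] L2 d →L[ℝ] ℝ)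
      (m.comp (sobolevVal U)) (sobolevVal U)

theorem energyForm_apply (m : L2 d →L[ℝ] L2 d) (x y : sobolevSubmodule U) :
    energyForm U m x y = 1 / 2 * inner ℝ (sobolevGrad U x) (sobolevGrad U y) +
      inner ℝ (m (sobolevVal U x)) (sobolevVal U y) := rfl

/-- Multiplication by a bounded measurable function, as an operator on `L²`. -/
theorem exists_mulOperator {W : E d → ℝ} (hW : Measurable W) {M : ℝ} (hM : ∀ x, |W x| ≤ M) :
    ∃ m : L2 d →L[ℝ] L2 d, ∀ u, (m u : E d → ℝ) =ᵐ[volume] fun x => W x * u x := by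
  have hW' : MemLp W ∞ (volume : Measure (E d)) :=
    memLp_top_of_bound hW.aestronglyMeasurable M (Eventually.of_forall hM)
  refine ⟨(ContinuousLinearMap.mul ℝ ℝ).holderL volume ∞ 2 2 (hW'.toLp W), fun u => ?_⟩
  have h1 := (ContinuousLinearMap.mul ℝ ℝ).coeFn_holder (r := 2) (hW'.toLp W) u
  filter_upwards [h1, hW'.coeFn_toLp] with x h2 h3
  rw [ContinuousLinearMap.holderL_apply_apply, h2, h3]
  rfl

end Form

/-! ### Variational bounds for Dirichlet eigenvalues. -/

section Eigenvalues

variable {d : ℕ} {U : Set (E d)} {V : E d → ℝ} {s : ℝ}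

open Classical in
/-- The potential of the positive form of the operator `s + 1 - ½Δ - V` on `U`. -/
noncomputable def shiftedPotential (V : E d → ℝ) (U : Set (E d)) (s : ℝ) (x : E d) : ℝ :=
  -- The value off `U` never meets a test function; `1` keeps the potential bounded and at least `1`
  -- everywhere.
  if x ∈ U then s + 1 - V x else 1

theorem shiftedPotential_of_mem {x : E d} (hx : x ∈ U) :
    shiftedPotential V U s x = s + 1 - V x := if_pos hx

theorem one_le_shiftedPotential (hs : ∀ x ∈ U, V x ≤ s) (x : E d) :
    1 ≤ shiftedPotential V U s x := by
  unfold shiftedPotential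
  split_ifs with h
  · linarith [hs x h]
  · exact le_rfl

theorem measurable_shiftedPotential (hV : Continuous V) (hU : MeasurableSet U) :
    Measurable (shiftedPotential V U s) :=
  Measurable.ite hU (measurable_const.sub hV.measurable) measurable_const

theorem exists_bound_shiftedPotential (hV : Continuous V) (hUb : Bornology.IsBounded U) :
    ∃ M, ∀ x, |shiftedPotential V U s x| ≤ M := by
  obtain ⟨C, hC⟩ := hUb.isCompact_closure.exists_bound_of_continuousOn hV.continuousOn
  refine ⟨|s + 1| + |C| + 1, fun x => ?_⟩
  unfold shiftedPotential
  split_ifs with h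
  · have h1 := hC x (subset_closure h)
    rw [Real.norm_eq_abs] at h1
    have h2 := abs_sub (s + 1) (V x)
    have h3 := le_abs_self C
    linarith
  · rw [abs_one]
    linarith [abs_nonneg (s + 1), abs_nonneg C]

theorem L2_inner_eq (u v : L2 d) : inner ℝ u v = ∫ x, u x * v x := by
  rw [L2.inner_def]
  refine integral_congr_ae (Eventually.of_forall fun x => ?_)
  simp [mul_comm]

theorem L2_integrable_mul (u v : L2 d) : Integrable fun x => u x * v x := by
  have := L2.integrable_inner (𝕜 := ℝ) v u
  simpa [mul_comm] using! this

variable {m : L2 d →L[ℝ] L2 d}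
  (hm : ∀ u, (m u : E d → ℝ) =ᵐ[volume] fun x => shiftedPotential V U s x * u x)

include hm

/-- `V` may be unbounded off `U`, so integrability is taken from the bounded shifted potential. The
two agree up to the shift on `U`, and off `U` the test function vanishes. -/
theorem energyForm_toSobolev {φ : E d → ℝ} (hφ : IsTestFunction U φ) (x : sobolevSubmodule U) :
    energyForm U m x hφ.toSobolev = 1 / 2 * (∫ y, inner ℝ (sobolevGrad U x y) (∇ φ y)) +
      ((s + 1) * (∫ y, sobolevVal U x y * φ y) - ∫ y, V y * sobolevVal U x y * φ y) := by
  set u := sobolevVal U x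
  rw [energyForm_apply, L2.inner_def, L2_inner_eq]
  congr 1
  · congr 1
    refine integral_congr_ae ?_
    filter_upwards [hφ.coeFn_grad] with y hy
    rw [hy]
  · have i1 : Integrable fun y => u y * φ y := by
      refine (L2_integrable_mul u (sobolevVal U hφ.toSobolev)).congr ?_
      filter_upwards [hφ.coeFn_val] with y hy
      rw [hy]
    have i2 : Integrable fun y => shiftedPotential V U s y * u y * φ y := by
      refine (L2_integrable_mul (m u) (sobolevVal U hφ.toSobolev)).congr ?_
      filter_upwards [hφ.coeFn_val, hm u] with y hy h2
      rw [hy, h2]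
    have h1 : ∀ y, V y * u y * φ y =
        (s + 1) * (u y * φ y) - shiftedPotential V U s y * u y * φ y := by
      intro y
      by_cases hy : y ∈ U
      · rw [shiftedPotential_of_mem hy]; ring
      · rw [hφ.eq_zero hy]; ring
    simp_rw [h1]
    rw [integral_sub (i1.const_mul _) i2, integral_const_mul, sub_sub_cancel]
    refine integral_congr_ae ?_
    filter_upwards [hφ.coeFn_val, hm u] with y hy h2
    rw [hy, h2]

theorem energyForm_symm (x y : sobolevSubmodule U) : energyForm U m x y = energyForm U m y x := by
  rw [energyForm_apply, energyForm_apply, real_inner_comm, L2_inner_eq, L2_inner_eq]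
  congr 1
  refine integral_congr_ae ?_
  filter_upwards [hm (sobolevVal U x), hm (sobolevVal U y)] with z h1 h2
  rw [h1, h2]; ring

theorem le_energyForm_self (hs : ∀ x ∈ U, V x ≤ s) (x : sobolevSubmodule U) :
    1 / 2 * ‖sobolevGrad U x‖ ^ 2 + ‖sobolevVal U x‖ ^ 2 ≤ energyForm U m x x := by
  rw [energyForm_apply, real_inner_self_eq_norm_sq, ← real_inner_self_eq_norm_sq (sobolevVal U x),
    L2_inner_eq, L2_inner_eq]
  refine add_le_add_right ?_ _
  refine integral_mono_ae (L2_integrable_mul _ _) (L2_integrable_mul _ _) ?_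
  filter_upwards [hm (sobolevVal U x)] with z h1
  rw [h1, mul_assoc]
  exact le_mul_of_one_le_left (mul_self_nonneg _) (one_le_shiftedPotential hs z)

theorem isCoercive_energyForm (hs : ∀ x ∈ U, V x ≤ s) : IsCoercive (energyForm U m) := by
  refine ⟨1 / 2, by norm_num, fun x => ?_⟩
  have h1 := le_energyForm_self hm hs x
  have h2 := sobolev_norm_sq x
  nlinarith [sq_nonneg ‖sobolevVal U x‖]

/-- Density of test functions extends the weak equation to all of `H¹₀(U)`. The substitution `μ ↦ s
+ 1 - μ` reverses the order: large eigenvalues of the operator are small eigenvalues of the coercive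
form. -/
theorem dirichletImage_iff (x : sobolevSubmodule U) (μ : ℝ) :
    (∀ φ : E d → ℝ, IsTestFunction U φ → (∫ y, V y * sobolevVal U x y * φ y) -
      (1 / 2) * (∫ y, inner ℝ (sobolevGrad U x y) (∇ φ y)) =
        ∫ y, (μ • sobolevVal U x : L2 d) y * φ y) ↔
    ∀ v, energyForm U m x v = (s + 1 - μ) * inner ℝ (sobolevVal U x) (sobolevVal U v) := by
  have key : ∀ (φ : E d → ℝ) (hφ : IsTestFunction U φ),
      ((∫ y, V y * sobolevVal U x y * φ y) -
      (1 / 2) * (∫ y, inner ℝ (sobolevGrad U x y) (∇ φ y)) =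
        ∫ y, (μ • sobolevVal U x : L2 d) y * φ y) ↔
      energyForm U m x hφ.toSobolev =
        (s + 1 - μ) * inner ℝ (sobolevVal U x) (sobolevVal U hφ.toSobolev) := by
    intro φ hφ
    have h1 : ∫ y, (μ • sobolevVal U x : L2 d) y * φ y = μ * ∫ y, sobolevVal U x y * φ y := by
      rw [← integral_const_mul]
      refine integral_congr_ae ?_
      filter_upwards [Lp.coeFn_smul μ (sobolevVal U x)] with y hy
      rw [hy, Pi.smul_apply, smul_eq_mul, mul_assoc]
    have h2 : inner ℝ (sobolevVal U x) (sobolevVal U hφ.toSobolev) =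
        ∫ y, sobolevVal U x y * φ y := by
      rw [L2_inner_eq]
      refine integral_congr_ae ?_
      filter_upwards [hφ.coeFn_val] with y hy
      rw [hy]
    rw [energyForm_toSobolev hm hφ, h1, h2]
    constructor <;> intro h <;> linarith
  constructor
  · intro h
    have := sobolev_ext (l := energyForm U m x)
      (m := (s + 1 - μ) • (innerSL ℝ (sobolevVal U x)).comp (sobolevVal U))
      fun φ hφ => (key φ hφ).1 (h φ hφ)
    exact fun v => DFunLike.congr_fun this v
  · exact fun h φ hφ => (key φ hφ).2 (h _)

omit hm

/-- Dirichlet eigenvalues are bounded by the supremum of the potential. -/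
theorem le_of_hasEigenvaluesAbove (hV : Continuous V) (hUb : Bornology.IsBounded U)
    (hU : MeasurableSet U) (hs : ∀ x ∈ U, V x ≤ s) {k : ℕ} (hk : 1 ≤ k) {a : ℝ}
    (h : HasEigenvaluesAbove V U k a) : a ≤ s := by
  obtain ⟨M, hM⟩ := exists_bound_shiftedPotential (s := s) hV hUb
  obtain ⟨m, hm⟩ := exists_mulOperator (measurable_shiftedPotential hV hU) hM
  obtain ⟨u, -, hu⟩ := h
  obtain ⟨μ, haμ, hu0, g, hg, heq⟩ := hu ⟨0, hk⟩
  obtain ⟨x, hx1, hx2⟩ := exists_sobolev hg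
  simp only at hx1 hx2
  rw [← hx1] at heq hu0
  rw [← hx2] at heq
  -- Testing with the eigenfunction itself gives `‖u‖² ≤ (s + 1 - μ) ‖u‖²`, hence `μ ≤ s`.
  have h1 := (dirichletImage_iff hm x μ).1 heq x
  have h2 := le_energyForm_self hm hs x
  rw [h1, real_inner_self_eq_norm_sq] at h2
  have h3 : 0 < ‖sobolevVal U x‖ ^ 2 := by positivity
  have h4 : 1 * ‖sobolevVal U x‖ ^ 2 ≤ (s + 1 - μ) * ‖sobolevVal U x‖ ^ 2 := by
    nlinarith [sq_nonneg ‖sobolevGrad U x‖]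
  have := le_of_mul_le_mul_right h4 h3
  linarith

/-- The variational lower bound on the number of large eigenvalues. -/
theorem hasEigenvaluesAbove_of_disjoint (hV : Continuous V) (hUb : Bornology.IsBounded U)
    (hU : MeasurableSet U) (hs : ∀ x ∈ U, V x ≤ s) {k : ℕ} (hk : 1 ≤ k) {b κ : ℝ}
    (φ : Fin k → E d → ℝ) (hφ : ∀ i, IsTestFunction U (φ i))
    (hdisj : ∀ i j, i ≠ j → Disjoint (tsupport (φ i)) (tsupport (φ j)))
    (hVb : ∀ i, ∀ x ∈ tsupport (φ i), b ≤ V x)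
    (hkin : ∀ i, 1 / 2 * ∫ x, ‖∇ (φ i) x‖ ^ 2 < κ * ∫ x, φ i x ^ 2) :
    HasEigenvaluesAbove V U k (b - κ) := by
  obtain ⟨M, hM⟩ := exists_bound_shiftedPotential (s := s) hV hUb
  obtain ⟨m, hm⟩ := exists_mulOperator (measurable_shiftedPotential hV hU) hM
  set w : Fin k → sobolevSubmodule U := fun i => (hφ i).toSobolev with hw
  have hnorm : ∀ i, ‖sobolevVal U (w i)‖ ^ 2 = ∫ x, φ i x ^ 2 := by
    intro i
    rw [← real_inner_self_eq_norm_sq, L2_inner_eq]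
    refine integral_congr_ae ?_
    filter_upwards [(hφ i).coeFn_val] with y hy
    rw [hy, sq]
  have hgrad : ∀ i, ‖sobolevGrad U (w i)‖ ^ 2 = ∫ x, ‖∇ (φ i) x‖ ^ 2 := by
    intro i
    rw [← real_inner_self_eq_norm_sq, L2.inner_def]
    refine integral_congr_ae ?_
    filter_upwards [(hφ i).coeFn_grad] with y hy
    rw [hy, real_inner_self_eq_norm_sq]
  have hprod : ∀ i j, i ≠ j → ∀ x, φ i x * φ j x = 0 := by
    intro i j hij x
    by_cases hx : x ∈ tsupport (φ i)
    · rw [image_eq_zero_of_notMem_tsupport fun h => (Set.disjoint_left.1 (hdisj i j hij)) hx h,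
        mul_zero]
    · rw [image_eq_zero_of_notMem_tsupport hx, zero_mul]
  have horth : ∀ i j, i ≠ j → inner ℝ (sobolevVal U (w i)) (sobolevVal U (w j)) = 0 := by
    intro i j hij
    rw [L2_inner_eq]
    refine integral_eq_zero_of_ae ?_
    filter_upwards [(hφ i).coeFn_val, (hφ j).coeFn_val] with y h1 h2
    rw [h1, h2, hprod i j hij]; rfl
  -- Disjoint supports make both the form and the `L²` product diagonal on the `w i`, so a bound for
  -- each bump passes to every linear combination.
  have hB0 : ∀ i j, i ≠ j → energyForm U m (w i) (w j) = 0 := by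
    intro i j hij
    rw [energyForm_apply, L2.inner_def, L2_inner_eq]
    have h1 : ∫ a, inner ℝ (sobolevGrad U (w i) a) (sobolevGrad U (w j) a) = 0 := by
      refine integral_eq_zero_of_ae ?_
      filter_upwards [(hφ i).coeFn_grad, (hφ j).coeFn_grad] with y h1 h2
      rw [h1, h2]
      by_cases hx : y ∈ tsupport (φ i)
      · have : y ∉ tsupport (∇ (φ j)) := fun h =>
          (Set.disjoint_left.1 (hdisj i j hij)) hx (tsupport_gradient_subset h)
        simp [image_eq_zero_of_notMem_tsupport this]
      · have : y ∉ tsupport (∇ (φ i)) := fun h => hx (tsupport_gradient_subset h)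
        simp [image_eq_zero_of_notMem_tsupport this]
    have h2 : ∫ x, m (sobolevVal U (w i)) x * sobolevVal U (w j) x = 0 := by
      refine integral_eq_zero_of_ae ?_
      filter_upwards [(hφ i).coeFn_val, (hφ j).coeFn_val, hm (sobolevVal U (w i))] with y h1 h2 h3
      rw [h3, h1, h2, mul_assoc, hprod i j hij, mul_zero]; rfl
    rw [h1, h2]; ring
  have hmle : ∀ i, inner ℝ (m (sobolevVal U (w i))) (sobolevVal U (w i)) ≤
      (s + 1 - b) * ‖sobolevVal U (w i)‖ ^ 2 := by
    intro i
    rw [← real_inner_self_eq_norm_sq, L2_inner_eq, L2_inner_eq, ← integral_const_mul]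
    refine integral_mono_ae (L2_integrable_mul _ _) ((L2_integrable_mul _ _).const_mul _) ?_
    filter_upwards [(hφ i).coeFn_val, hm (sobolevVal U (w i))] with y h1 h2
    rw [h2, h1, mul_assoc]
    by_cases hy : y ∈ tsupport (φ i)
    · rw [shiftedPotential_of_mem ((hφ i).tsupport_subset hy)]
      exact mul_le_mul_of_nonneg_right (by linarith [hVb i y hy]) (mul_self_nonneg _)
    · simp [image_eq_zero_of_notMem_tsupport hy]
  -- The threshold `b - κ` in the form picture: `c = s + 1 - (b - κ)`.
  set c : ℝ := κ + (s + 1 - b) with hc_def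
  have hBlt : ∀ i, energyForm U m (w i) (w i) < c * ‖sobolevVal U (w i)‖ ^ 2 := by
    intro i
    have h1 := hkin i
    rw [← hnorm, ← hgrad] at h1
    have h2 := hmle i
    rw [energyForm_apply, real_inner_self_eq_norm_sq, hc_def]
    linarith
  -- The strict kinetic inequality cannot hold for the zero function, so no separate nonvanishing
  -- hypothesis is needed.
  have hpos : ∀ i, 0 < c ∧ sobolevVal U (w i) ≠ 0 := by
    intro i
    have h1 := (le_energyForm_self hm hs (w i)).trans_lt (hBlt i)
    have h2 : 0 < c * ‖sobolevVal U (w i)‖ ^ 2 := lt_of_le_of_lt (by positivity) h1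
    have h3 := sq_nonneg ‖sobolevVal U (w i)‖
    refine ⟨pos_of_mul_pos_left h2 h3, fun h0 => ?_⟩
    rw [h0] at h2; simp at h2
  have hc : 0 < c := (hpos ⟨0, hk⟩).1
  have hli : LinearIndependent ℝ (sobolevVal U ∘ w) :=
    linearIndependent_of_ne_zero_of_inner_eq_zero (fun i => (hpos i).2) fun i j hij => horth i j hij
  obtain ⟨u, hu, hev⟩ := exists_form_eigenvectors (sobolevVal U)
    (isCompactOperator_sobolevVal hUb hU) (energyForm U m) (isCoercive_energyForm hm hs)
    (energyForm_symm hm) hc w hli (by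
      intro v hv hv0
      obtain ⟨t, rfl⟩ := (Submodule.mem_span_range_iff_exists_fun ℝ).1 hv
      have h1 : energyForm U m (∑ i, t i • w i) (∑ i, t i • w i) =
          ∑ i, t i ^ 2 * energyForm U m (w i) (w i) := by
        rw [map_sum]
        refine Finset.sum_congr rfl fun i _ => ?_
        rw [map_smul, map_sum, _root_.sum_apply, Finset.sum_eq_single i]
        · simp; ring
        · intro j _ hj; simp [hB0 j i hj]
        · simp
      have h2 : ‖sobolevVal U (∑ i, t i • w i)‖ ^ 2 = ∑ i, t i ^ 2 * ‖sobolevVal U (w i)‖ ^ 2 := by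
        rw [← real_inner_self_eq_norm_sq, map_sum, sum_inner]
        refine Finset.sum_congr rfl fun i _ => ?_
        rw [inner_sum, Finset.sum_eq_single i]
        · rw [map_smul, inner_smul_left, inner_smul_right, real_inner_self_eq_norm_sq]; simp; ring
        · intro j _ hj
          rw [map_smul, map_smul, inner_smul_left, inner_smul_right, horth i j hj.symm]; simp
        · simp
      rw [h1, h2, Finset.mul_sum]
      obtain ⟨i, hi⟩ : ∃ i, t i ≠ 0 := by
        by_contra! h
        exact hv0 (by simp [h])
      refine Finset.sum_lt_sum (fun j _ => ?_) ⟨i, Finset.mem_univ _, ?_⟩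
      · have := mul_le_mul_of_nonneg_left (hBlt j).le (sq_nonneg (t j))
        linarith
      · have := mul_lt_mul_of_pos_left (hBlt i) (sq_pos_of_ne_zero hi)
        linarith)
  refine ⟨fun i => sobolevVal U (u i), hu, fun i => ?_⟩
  obtain ⟨μ, hμ, hform⟩ := hev i
  refine ⟨s + 1 - μ, by linarith, hu.ne_zero i, sobolevGrad U (u i), sobolev_mem _, ?_⟩
  refine (dirichletImage_iff hm (u i) (s + 1 - μ)).2 fun v => ?_
  rw [hform]; ring

/-- Smooth bumps in balls, with kinetic energy of the order of the inverse square radius. -/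
theorem exists_bump (d : ℕ) : ∃ κ : ℝ, 0 < κ ∧ ∀ (y : E d) (ρ : ℝ), 0 < ρ →
    ∃ φ : E d → ℝ, IsTestFunction (Metric.ball y ρ) φ ∧
      1 / 2 * ∫ x, ‖∇ φ x‖ ^ 2 < κ / ρ ^ 2 * ∫ x, φ x ^ 2 := by
  -- Outer radius below `1`, so that the closed support stays inside the open ball after scaling.
  let ψ : ContDiffBump (0 : E d) := ⟨1 / 4, 1 / 2, by norm_num, by norm_num⟩
  have hψ1 : ContDiff ℝ (⊤ : ℕ∞) ψ := ψ.contDiff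
  have hψ1' : ContDiff ℝ 1 ψ := ψ.contDiff
  set I := ∫ x, (ψ x) ^ 2 with hI
  set G := ∫ x, ‖∇ ψ x‖ ^ 2 with hG
  have hIpos : 0 < I := by
    have hc : Continuous fun x => (ψ x) ^ 2 := ψ.continuous.pow 2
    refine hc.integral_pos_of_hasCompactSupport_nonneg_nonzero ?_ (fun x => sq_nonneg _)
      (x := 0) ?_
    · exact ψ.hasCompactSupport.comp_left (g := fun t : ℝ => t ^ 2) (by simp)
    · have : ψ 0 = 1 := ψ.one_of_mem_closedBall (Metric.mem_closedBall_self (by norm_num [ψ]))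
      simp [this]
  have hGnn : 0 ≤ G := integral_nonneg fun x => sq_nonneg _
  -- `G / (2 * I)` is the kinetic quotient of the unit bump; the `+ 1` makes the inequality strict.
  refine ⟨G / (2 * I) + 1, by positivity, fun y ρ hρ => ?_⟩
  set φ : E d → ℝ := fun x => ψ (ρ⁻¹ • (x - y)) with hφ
  have haff : ContDiff ℝ (⊤ : ℕ∞) fun x : E d => ρ⁻¹ • (x - y) := by fun_prop
  have hsmooth : ContDiff ℝ (⊤ : ℕ∞) φ := hψ1.comp haff
  have htsup : tsupport φ ⊆ Metric.closedBall y (ρ / 2) := by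
    refine closure_minimal (fun x hx => ?_) Metric.isClosed_closedBall
    have h1 : ρ⁻¹ • (x - y) ∈ Function.support ψ := hx
    rw [ψ.support_eq, mem_ball_zero_iff, norm_smul, norm_inv, Real.norm_of_nonneg hρ.le] at h1
    rw [mem_closedBall_iff_norm]
    have h2 : ρ⁻¹ * ‖x - y‖ < 1 / 2 := h1
    rw [inv_mul_lt_iff₀ hρ] at h2
    linarith
  have hgr : ∀ x, ∇ φ x = ρ⁻¹ • ∇ ψ (ρ⁻¹ • (x - y)) := by
    intro x
    refine HasGradientAt.gradient ?_
    rw [hasGradientAt_iff_hasFDerivAt]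
    have h1 : HasFDerivAt ψ (InnerProductSpace.toDual ℝ (E d) (∇ ψ (ρ⁻¹ • (x - y))))
        (ρ⁻¹ • (x - y)) :=
      hasGradientAt_iff_hasFDerivAt.1 (hψ1'.differentiable one_ne_zero _).hasGradientAt
    have h2 : HasFDerivAt (fun x : E d => ρ⁻¹ • (x - y)) (ρ⁻¹ • ContinuousLinearMap.id ℝ (E d)) x :=
      ((hasFDerivAt_id x).sub_const y).const_smul ρ⁻¹
    refine (h1.comp x h2).congr_fderiv ?_
    ext v
    simp
  have hscale : ∀ F : E d → ℝ, ∫ x, F (ρ⁻¹ • (x - y)) = ρ ^ d * ∫ x, F x := by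
    intro F
    rw [integral_sub_right_eq_self (fun x => F (ρ⁻¹ • x)) y,
      Measure.integral_comp_inv_smul_of_nonneg volume F hρ.le]
    simp
  refine ⟨φ, ⟨hsmooth, ?_, ?_⟩, ?_⟩
  · exact (isCompact_closedBall y (ρ / 2)).of_isClosed_subset (isClosed_tsupport _) htsup
  · exact htsup.trans (Metric.closedBall_subset_ball (by linarith))
  · have h1 : ∫ x, φ x ^ 2 = ρ ^ d * I := hscale fun x => (ψ x) ^ 2
    have h2 : ∫ x, ‖∇ φ x‖ ^ 2 = (ρ⁻¹) ^ 2 * (ρ ^ d * G) := by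
      rw [hG, ← hscale fun x => ‖∇ ψ x‖ ^ 2, ← integral_const_mul]
      refine integral_congr_ae (Eventually.of_forall fun x => ?_)
      simp only [hgr, norm_smul, mul_pow, norm_inv, Real.norm_of_nonneg hρ.le]
    rw [h1, h2]
    have h3 : (G / (2 * I) + 1) / ρ ^ 2 * (ρ ^ d * I) =
        1 / 2 * ((ρ⁻¹) ^ 2 * (ρ ^ d * G)) + (ρ⁻¹) ^ 2 * (ρ ^ d * I) := by
      field_simp
    rw [h3]
    have : 0 < (ρ⁻¹) ^ 2 * (ρ ^ d * I) := by positivity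
    linarith

/-- The `k`-th eigenvalue is at most a nonnegative upper bound of the potential. -/
theorem dirichletEigenvalue_le (hV : Continuous V) (hUb : Bornology.IsBounded U)
    (hU : MeasurableSet U) (hs0 : 0 ≤ s) (hs : ∀ x ∈ U, V x ≤ s) {k : ℕ} (hk : 1 ≤ k) :
    dirichletEigenvalue V U k ≤ s :=
  -- `sSup ∅ = 0`, so `0 ≤ s` covers the case of too few eigenvalues.
  Real.sSup_le (fun _ ha => le_of_hasEigenvaluesAbove hV hUb hU hs hk ha) hs0

/-- If the potential is large on `k` disjoint balls, so is the `k`-th eigenvalue. -/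
theorem le_dirichletEigenvalue {κ : ℝ} (hκ : ∀ (y : E d) (ρ : ℝ), 0 < ρ →
      ∃ φ : E d → ℝ, IsTestFunction (Metric.ball y ρ) φ ∧
        1 / 2 * ∫ x, ‖∇ φ x‖ ^ 2 < κ / ρ ^ 2 * ∫ x, φ x ^ 2)
    (hV : Continuous V) (hUb : Bornology.IsBounded U) (hU : MeasurableSet U) {k : ℕ} (hk : 1 ≤ k)
    {ρ b : ℝ} (hρ : 0 < ρ) (y : Fin k → E d) (hyU : ∀ i, Metric.ball (y i) ρ ⊆ U)
    (hdisj : ∀ i j, i ≠ j → Disjoint (Metric.ball (y i) ρ) (Metric.ball (y j) ρ))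
    (hVb : ∀ i, ∀ x ∈ Metric.ball (y i) ρ, b ≤ V x) :
    b - κ / ρ ^ 2 ≤ dirichletEigenvalue V U k := by
  obtain ⟨C, hC⟩ := hUb.isCompact_closure.exists_bound_of_continuousOn hV.continuousOn
  have hs : ∀ x ∈ U, V x ≤ C := fun x hx => (le_abs_self _).trans (hC x (subset_closure hx))
  choose φ hφ hkin using fun i => hκ (y i) ρ hρ
  refine le_csSup ⟨C, fun a ha => le_of_hasEigenvaluesAbove hV hUb hU hs hk ha⟩ ?_
  exact hasEigenvaluesAbove_of_disjoint hV hUb hU hs hk φ (fun i => (hφ i).mono (hyU i))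
    (fun i j hij => (hdisj i j hij).mono (hφ i).tsupport_subset (hφ j).tsupport_subset)
    (fun i x hx => hVb i x ((hφ i).tsupport_subset hx)) hkin

end Eigenvalues

/-! ### Positivity, regularity and range of the covariance. -/

section Covariance

variable {d : ℕ} {Rbar : E d → ℝ}

theorem covarianceFun_apply (Rbar : E d → ℝ) (x : E d) :
    covarianceFun Rbar x = ∫ t, Rbar t * Rbar (x - t) := rfl

namespace IsCovarianceRoot

theorem continuous (h : IsCovarianceRoot Rbar) : Continuous Rbar := by
  obtain ⟨e, he, C, hC, hb⟩ := h.holder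
  rw [continuous_iff_continuousAt]
  intro x
  rw [ContinuousAt, tendsto_iff_dist_tendsto_zero]
  have hlim : Tendsto (fun y => C * ‖y - x‖ ^ e) (𝓝 x) (𝓝 0) := by
    have : Continuous fun y : E d => C * ‖y - x‖ ^ e :=
      continuous_const.mul ((continuous_id.sub continuous_const).norm.rpow_const
        fun _ => Or.inr he.le)
    simpa [he.ne'] using this.tendsto x
  exact squeeze_zero (fun _ => dist_nonneg) (fun y => by rw [Real.dist_eq]; exact hb y x) hlim

/-- By evenness `R(0) = ∫ Rbar²`, and `Rbar` is continuous and not identically zero since its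
integral is `1`. -/
theorem covarianceFun_zero_pos (h : IsCovarianceRoot Rbar) : 0 < covarianceFun Rbar 0 := by
  have h1 : covarianceFun Rbar 0 = ∫ t, Rbar t ^ 2 := by
    rw [covarianceFun_apply]
    refine integral_congr_ae (Eventually.of_forall fun t => ?_)
    simp only [zero_sub, h.even, sq]
  rw [h1]
  obtain ⟨x, hx⟩ : ∃ x, Rbar x ≠ 0 := by
    by_contra! h0
    have := h.integral_eq_one
    simp [h0] at this
  refine (h.continuous.pow 2).integral_pos_of_hasCompactSupport_nonneg_nonzero ?_
    (fun x => sq_nonneg _) (x := x) (by simpa using hx)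
  exact h.hasCompactSupport.comp_left (g := fun t : ℝ => t ^ 2) (by simp)

/-- The covariance function inherits the Hölder exponent at the origin. -/
theorem covarianceFun_zero_sub_le (h : IsCovarianceRoot Rbar) : ∃ e : ℝ, 0 < e ∧ ∃ C : ℝ, 0 < C ∧
    ∀ x, covarianceFun Rbar 0 - covarianceFun Rbar x ≤ C * ‖x‖ ^ e := by
  obtain ⟨e, he, C, hC, hb⟩ := h.holder
  refine ⟨e, he, C, hC, fun x => ?_⟩
  have hint : Integrable Rbar := h.continuous.integrable_of_hasCompactSupport h.hasCompactSupport
  have hi : ∀ x, Integrable fun t => Rbar t * Rbar (x - t) := by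
    intro x
    refine Continuous.integrable_of_hasCompactSupport ?_ h.hasCompactSupport.mul_right
    exact h.continuous.mul (h.continuous.comp (by fun_prop))
  rw [covarianceFun_apply, covarianceFun_apply, ← integral_sub (hi 0) (hi x)]
  calc ∫ t, (Rbar t * Rbar (0 - t) - Rbar t * Rbar (x - t))
      ≤ ∫ t, Rbar t * (C * ‖x‖ ^ e) := by
        refine integral_mono ((hi 0).sub (hi x)) (hint.mul_const _) fun t => ?_
        change Rbar t * Rbar (0 - t) - Rbar t * Rbar (x - t) ≤ Rbar t * (C * ‖x‖ ^ e)
        rw [← mul_sub]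
        refine mul_le_mul_of_nonneg_left ?_ (h.nonneg t)
        have := (le_abs_self _).trans (hb (0 - t) (x - t))
        rwa [sub_sub_sub_cancel_right, zero_sub x, norm_neg] at this
    _ = C * ‖x‖ ^ e := by rw [integral_mul_const, h.integral_eq_one, one_mul]

/-- A range of dependence of twice the support radius; this is the source of independence in the
second moment argument. -/
theorem exists_covarianceFun_eq_zero (h : IsCovarianceRoot Rbar) :
    ∃ r : ℝ, 0 < r ∧ ∀ x, r ≤ ‖x‖ → covarianceFun Rbar x = 0 := by
  obtain ⟨r, hr, hsub⟩ := h.hasCompactSupport.isCompact.isBounded.subset_ball_lt 0 0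
  refine ⟨2 * r, by positivity, fun x hx => ?_⟩
  rw [covarianceFun_apply]
  refine integral_eq_zero_of_ae (Eventually.of_forall fun t => ?_)
  by_cases ht : t ∈ tsupport Rbar
  · have h1 : ‖t‖ < r := by simpa using hsub ht
    have h2 : x - t ∉ tsupport Rbar := fun hmem => by
      have h3 : ‖x - t‖ < r := by simpa using hsub hmem
      have := norm_add_le (x - t) t
      rw [sub_add_cancel] at this
      linarith
    simp [image_eq_zero_of_notMem_tsupport h2]
  · simp [image_eq_zero_of_notMem_tsupport ht]

end IsCovarianceRoot

end Covariance

/-! ### Upper and lower Gaussian tail bounds. -/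

section GaussianTails

variable {Ω : Type*} [MeasurableSpace Ω] {P : Measure Ω} {Y : Ω → ℝ}

theorem map_eq_gaussianReal_of_centered (hY : HasGaussianLaw Y P) (h0 : ∫ ω, Y ω ∂P = 0) :
    P.map Y = gaussianReal 0 (∫ ω, Y ω * Y ω ∂P).toNNReal := by
  have := hY.map_eq_gaussianReal
  rw [h0, variance_of_integral_eq_zero hY.aemeasurable h0] at this
  simpa [sq] using this

/-- Chernoff bound through the sub-Gaussian moment generating function. Only an upper bound `w` on
the variance enters, so degenerate increments are allowed. -/
theorem measure_ge_le_of_gaussian (hY : HasGaussianLaw Y P) (h0 : ∫ ω, Y ω ∂P = 0) {w s : ℝ}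
    (hw : ∫ ω, Y ω * Y ω ∂P ≤ w) (hs : 0 ≤ s) :
    P {ω | s ≤ Y ω} ≤ ENNReal.ofReal (Real.exp (-s ^ 2 / (2 * w))) := by
  have := hY.isProbabilityMeasure
  have hmap := map_eq_gaussianReal_of_centered hY h0
  have hw0 : 0 ≤ w := (integral_nonneg fun ω => mul_self_nonneg _).trans hw
  have hsub : HasSubgaussianMGF Y w.toNNReal P := by
    constructor
    · intro t
      have : Integrable (fun x => Real.exp (t * x)) (P.map Y) := by
        rw [hmap]; exact integrable_exp_mul_gaussianReal t
      exact this.comp_aemeasurable hY.aemeasurable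
    · intro t
      rw [mgf_gaussianReal hmap, zero_mul, zero_add]
      refine Real.exp_le_exp.2 ?_
      have : ((∫ ω, Y ω * Y ω ∂P).toNNReal : ℝ) ≤ (w.toNNReal : ℝ) := by
        exact_mod_cast Real.toNNReal_le_toNNReal hw
      gcongr
  have h := hsub.measure_ge_le hs
  rw [Real.coe_toNNReal _ hw0] at h
  rw [← ofReal_measureReal]
  exact ENNReal.ofReal_le_ofReal h

theorem measure_abs_ge_le_of_gaussian (hY : HasGaussianLaw Y P) (h0 : ∫ ω, Y ω ∂P = 0) {w s : ℝ}
    (hw : ∫ ω, Y ω * Y ω ∂P ≤ w) (hs : 0 ≤ s) :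
    P {ω | s ≤ |Y ω|} ≤ 2 * ENNReal.ofReal (Real.exp (-s ^ 2 / (2 * w))) := by
  have h1 := measure_ge_le_of_gaussian hY h0 hw hs
  have h2 := measure_ge_le_of_gaussian (w := w) hY.fun_neg (by rw [integral_neg, h0, neg_zero])
    (by simpa using hw) hs
  have hsub : {ω | s ≤ |Y ω|} ⊆ {ω | s ≤ Y ω} ∪ {ω | s ≤ -Y ω} := fun ω hω => by
    simpa [le_abs] using hω
  calc _ ≤ _ := measure_mono hsub
    _ ≤ _ := measure_union_le _ _
    _ ≤ _ := add_le_add h1 h2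
    _ = _ := (two_mul _).symm

/-- The density on `[s, s + 1]` is at least its value at `s + 1`. The loss is harmless, since only
the quadratic term of the exponent matters later. -/
theorem le_measureReal_ge_of_gaussian (hY : HasGaussianLaw Y P) (h0 : ∫ ω, Y ω ∂P = 0) {v s : ℝ}
    (hv : ∫ ω, Y ω * Y ω ∂P = v) (hv0 : 0 < v) (hs : 0 ≤ s) :
    (√(2 * Real.pi * v))⁻¹ * Real.exp (-(s + 1) ^ 2 / (2 * v)) ≤ P.real {ω | s ≤ Y ω} := by
  have := hY.isProbabilityMeasure
  have hmap := map_eq_gaussianReal_of_centered hY h0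
  rw [hv] at hmap
  have hvn : v.toNNReal ≠ 0 := by simpa using hv0
  have hset : P.real {ω | s ≤ Y ω} = (P.map Y).real (Set.Ici s) := by
    rw [map_measureReal_apply_of_aemeasurable hY.aemeasurable measurableSet_Ici]; rfl
  rw [hset, hmap, Measure.real, gaussianReal_apply_eq_integral _ hvn, ENNReal.toReal_ofReal
    (integral_nonneg fun x => gaussianPDFReal_nonneg _ _ _)]
  calc (√(2 * Real.pi * v))⁻¹ * Real.exp (-(s + 1) ^ 2 / (2 * v))
      = ∫ x in Set.Icc s (s + 1), (√(2 * Real.pi * v))⁻¹ * Real.exp (-(s + 1) ^ 2 / (2 * v)) := by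
        simp
    _ ≤ ∫ x in Set.Icc s (s + 1), gaussianPDFReal 0 v.toNNReal x := by
        refine setIntegral_mono_on (integrableOn_const (by simp)) (integrable_gaussianPDFReal _ _).integrableOn
          measurableSet_Icc fun x hx => ?_
        rw [gaussianPDFReal, Real.coe_toNNReal _ hv0.le, sub_zero]
        have h1 : x ^ 2 ≤ (s + 1) ^ 2 := pow_le_pow_left₀ (hs.trans hx.1) hx.2 2
        gcongr
    _ ≤ ∫ x in Set.Ici s, gaussianPDFReal 0 v.toNNReal x :=
        setIntegral_mono_set (integrable_gaussianPDFReal _ _).integrableOn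
          (Eventually.of_forall fun x => gaussianPDFReal_nonneg _ _ _)
          (LE.le.eventuallyLE Set.Icc_subset_Ici_self)

end GaussianTails

/-! ### Lattices, dyadic refinement and deterministic chaining. -/

section Mesh

variable {d : ℕ}

/-- The point of the lattice `a ℤᵈ` with index `m`. -/
noncomputable def meshPoint (a : ℝ) (m : Fin d → ℤ) : E d := WithLp.toLp 2 fun i => a * m i

/-- The index of the cell of the lattice `a ℤᵈ` that contains `x`. -/
noncomputable def meshIndex (a : ℝ) (x : E d) : Fin d → ℤ := fun i => ⌊x i / a⌋

/-- The indices of the lattice points relevant for the box of size `L`. -/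
noncomputable def meshBox (d : ℕ) (a L : ℝ) : Finset (Fin d → ℤ) :=
  Fintype.piFinset fun _ => Finset.Icc (-(⌈L / a⌉₊ : ℤ)) ⌈L / a⌉₊

@[simp] theorem meshPoint_apply (a : ℝ) (m : Fin d → ℤ) (i : Fin d) :
    meshPoint a m i = a * m i := rfl

theorem meshIndex_mem_meshBox {a L : ℝ} (ha : 0 < a) {x : E d} (hx : x ∈ box d L) :
    meshIndex a x ∈ meshBox d a L := by
  rw [meshBox, Fintype.mem_piFinset]
  intro i
  have h := hx i
  have h1 : L / a ≤ ⌈L / a⌉₊ := Nat.le_ceil _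
  have h2 : x i / a < L / a := div_lt_div_of_pos_right h.2 ha
  have h3 : -(L / a) < x i / a := by
    rw [← neg_div]; exact div_lt_div_of_pos_right h.1 ha
  rw [Finset.mem_Icc]
  constructor
  · refine Int.le_floor.2 ?_
    push_cast
    linarith
  · refine Int.le_of_lt_add_one (Int.floor_lt.2 ?_)
    push_cast
    linarith

/-- The refinement factor `b` is `2 ^ (n + 1)` in the chaining and `1` for the unrefined lattice. -/
theorem card_meshBox_le {a L : ℝ} (ha : 0 < a) (hL : 1 ≤ L) {b : ℝ} (hb : 1 ≤ b) :
    ((meshBox d (a / b) L).card : ℝ) ≤ ((2 / a + 3) * (b * L)) ^ d := by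
  have h1 : (meshBox d (a / b) L).card = (2 * ⌈L / (a / b)⌉₊ + 1) ^ d := by
    rw [meshBox, Fintype.card_piFinset_const, Int.card_Icc]
    congr 1
    omega
  rw [h1]
  push_cast
  have h2 : L / (a / b) = b * L / a := by field_simp
  have h3 : (⌈L / (a / b)⌉₊ : ℝ) < L / (a / b) + 1 := Nat.ceil_lt_add_one (by positivity)
  have h4 : 1 ≤ b * L := one_le_mul_of_one_le_of_one_le hb hL
  gcongr
  rw [h2] at h3
  have : (2 / a + 3) * (b * L) = 2 * (b * L / a) + 3 * (b * L) := by ring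
  rw [this, h2]
  linarith

theorem norm_sub_meshPoint_le {a c : ℝ} {m : Fin d → ℤ} {x : E d}
    (h : ∀ i, |x i - a * m i| ≤ c) (hc : 0 ≤ c) : ‖x - meshPoint a m‖ ≤ √d * c := by
  rw [EuclideanSpace.norm_eq]
  have h1 : ∑ i, ‖(x - meshPoint a m) i‖ ^ 2 ≤ d * c ^ 2 := by
    calc ∑ i, ‖(x - meshPoint a m) i‖ ^ 2 ≤ ∑ _i : Fin d, c ^ 2 := by
          refine Finset.sum_le_sum fun i _ => ?_
          rw [PiLp.sub_apply, meshPoint_apply, Real.norm_eq_abs]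
          exact pow_le_pow_left₀ (abs_nonneg _) (h i) 2
      _ = d * c ^ 2 := by simp
  calc _ ≤ √(d * c ^ 2) := Real.sqrt_le_sqrt h1
    _ = √d * c := by rw [Real.sqrt_mul (Nat.cast_nonneg d), Real.sqrt_sq hc]

theorem norm_sub_meshPoint_meshIndex_le {a : ℝ} (ha : 0 < a) (x : E d) :
    ‖x - meshPoint a (meshIndex a x)‖ ≤ √d * a := by
  refine norm_sub_meshPoint_le (fun i => ?_) ha.le
  have h1 := Int.floor_le (x i / a)
  have h2 := (Int.lt_floor_add_one (x i / a)).le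
  rw [le_div_iff₀ ha] at h1
  rw [div_le_iff₀ ha] at h2
  rw [meshIndex, abs_le]
  constructor <;> linarith

/-- The parent of a dyadic cell is found by integer division of its index. A chaining step is thus
determined by the finer index alone, and the union bound runs over one lattice per scale. -/
theorem meshIndex_half (a : ℝ) (x : E d) :
    meshIndex a x = fun i => meshIndex (a / 2) x i / 2 := by
  funext i
  have h := Int.floor_div_natCast (x i / (a / 2)) 2
  simp only [meshIndex]
  push_cast at h
  rw [← h]
  congr 1
  ring

theorem norm_meshPoint_half_sub_le {a : ℝ} (ha : 0 < a) (m : Fin d → ℤ) :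
    ‖meshPoint (a / 2) m - meshPoint a fun i => m i / 2‖ ≤ √d * a := by
  refine norm_sub_meshPoint_le (fun i => ?_) ha.le
  rw [meshPoint_apply]
  have h1 : m i = 2 * (m i / 2) + m i % 2 := (Int.mul_ediv_add_emod _ _).symm
  have h2 : (m i : ℝ) = 2 * ((m i / 2 : ℤ) : ℝ) + ((m i % 2 : ℤ) : ℝ) := by exact_mod_cast h1
  have h3 : ((m i % 2 : ℤ) : ℝ) = 0 ∨ ((m i % 2 : ℤ) : ℝ) = 1 := by
    rcases Int.emod_two_eq_zero_or_one (m i) with h | h <;> simp [h]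
  rw [h2]
  rcases h3 with h | h <;> rw [h, abs_le] <;> constructor <;> nlinarith

/-- Deterministic chaining along dyadic refinements of the lattice. -/
theorem abs_sub_meshPoint_le {f : E d → ℝ} (hf : Continuous f) {a : ℝ} (ha : 0 < a) (x : E d)
    {s : ℕ → ℝ} (hs : Summable s)
    (h : ∀ n : ℕ, |f (meshPoint (a / 2 ^ (n + 1)) (meshIndex (a / 2 ^ (n + 1)) x)) -
      f (meshPoint (a / 2 ^ n) fun i => meshIndex (a / 2 ^ (n + 1)) x i / 2)| ≤ s n) :
    |f x - f (meshPoint a (meshIndex a x))| ≤ ∑' n, s n := by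
  set z : ℕ → E d := fun n => meshPoint (a / 2 ^ n) (meshIndex (a / 2 ^ n) x) with hz
  have hz0 : z 0 = meshPoint a (meshIndex a x) := by simp [hz]
  have hlim : Tendsto z atTop (𝓝 x) := by
    rw [tendsto_iff_norm_sub_tendsto_zero]
    have h1 : Tendsto (fun n : ℕ => √d * (a / 2 ^ n)) atTop (𝓝 0) := by
      have := (tendsto_pow_atTop_nhds_zero_of_lt_one (r := (1 / 2 : ℝ)) (by norm_num)
        (by norm_num)).const_mul (√d * a)
      rw [mul_zero] at this
      refine this.congr fun n => ?_
      rw [one_div, inv_pow]; ring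
    refine squeeze_zero (fun _ => norm_nonneg _) (fun n => ?_) h1
    rw [norm_sub_rev]
    exact norm_sub_meshPoint_meshIndex_le (by positivity) x
  have hstep : ∀ n, dist (f (z n)) (f (z n.succ)) ≤ s n := by
    intro n
    rw [dist_comm, Real.dist_eq]
    have h1 : meshIndex (a / 2 ^ n) x = fun i => meshIndex (a / 2 ^ (n + 1)) x i / 2 := by
      rw [meshIndex_half, pow_succ, div_div]
    have := h n
    rw [← h1] at this
    exact this
  have := dist_le_tsum_of_dist_le_of_tendsto₀ s hstep hs ((hf.tendsto x).comp hlim)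
  rw [hz0, dist_comm, Real.dist_eq] at this
  exact this

end Mesh

/-! ### Oscillation, upper tails and high points of the noise. -/

section Noise

variable {d : ℕ} {Ω : Type*} [MeasurableSpace Ω] {P : Measure Ω} {R : E d → ℝ} {ξ : E d → Ω → ℝ}

namespace IsStationaryGaussianNoise

theorem memLp_two (h : IsStationaryGaussianNoise P R ξ) (x : E d) : MemLp (ξ x) 2 P :=
  (h.gaussian.hasGaussianLaw_eval x).memLp_two

theorem integral_sq_sub (h : IsStationaryGaussianNoise P R ξ) (x y : E d) :
    ∫ ω, (ξ x ω - ξ y ω) * (ξ x ω - ξ y ω) ∂P = 2 * (R 0 - R (x - y)) := by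
  have hi : ∀ x y, Integrable (fun ω => ξ x ω * ξ y ω) P := fun x y =>
    (h.memLp_two x).integrable_mul (h.memLp_two y)
  have h1 : ∀ ω, (ξ x ω - ξ y ω) * (ξ x ω - ξ y ω) =
      ξ x ω * ξ x ω + ξ y ω * ξ y ω - 2 * (ξ x ω * ξ y ω) := fun ω => by ring
  simp_rw [h1]
  have hadd : Integrable (fun ω => ξ x ω * ξ x ω + ξ y ω * ξ y ω) P := (hi x x).add (hi y y)
  rw [integral_sub hadd ((hi x y).const_mul 2), integral_add (hi x x) (hi y y),
    integral_const_mul, h.covariance, h.covariance, h.covariance, sub_self, sub_self]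
  ring

theorem integral_sub_eq_zero (h : IsStationaryGaussianNoise P R ξ) (x y : E d) :
    ∫ ω, (ξ x ω - ξ y ω) ∂P = 0 := by
  have := h.gaussian.isProbabilityMeasure
  rw [integral_sub ((h.memLp_two x).integrable one_le_two) ((h.memLp_two y).integrable one_le_two),
    h.centered, h.centered, sub_zero]

theorem indepFun (h : IsStationaryGaussianNoise P R ξ) {x y : E d} (hxy : R (x - y) = 0) :
    IndepFun (ξ x) (ξ y) P := by
  have := h.gaussian.isProbabilityMeasure
  refine HasGaussianLaw.indepFun_of_covariance_eq_zero h.gaussian.hasGaussianLaw_prodMk ?_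
  rw [covariance_eq_sub (h.memLp_two x) (h.memLp_two y), h.centered, zero_mul, sub_zero]
  simpa [hxy] using h.covariance x y

end IsStationaryGaussianNoise

/-- The sum over scales in the chaining argument. -/
theorem chaining_term_le {K L A q : ℝ} (hL : Real.exp 1 ≤ L) (hK : 0 ≤ K)
    (hq : 1 < q) (hA1 : (d : ℝ) + 1 ≤ A) (hA2 : ((d : ℝ) + 1) * Real.log 2 ≤ A * (q - 1)) (n : ℕ) :
    (K * (2 ^ (n + 1) * L)) ^ d * (2 * Real.exp (-(A * Real.log L * q ^ n))) ≤
      2 ^ (d + 1) * K ^ d * L⁻¹ * (1 / 2) ^ n := by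
  have hL0 : 0 < L := (Real.exp_pos 1).trans_le hL
  have hlog : 1 ≤ Real.log L := (Real.le_log_iff_exp_le hL0).2 hL
  have hlog2 : 0 < Real.log 2 := Real.log_pos one_lt_two
  have hA0 : 0 ≤ A := le_trans (by positivity) hA1
  -- Bernoulli: linear growth in `n` already beats the number of lattice points.
  have h1 : 1 + n * (q - 1) ≤ q ^ n := by
    have := one_add_mul_le_pow (a := q - 1) (by linarith) n
    rwa [add_sub_cancel] at this
  -- The exponent pays for `d + 1` powers of `L` and of `2 ^ n`, while the lattice has order `(2 ^ n
  -- L) ^ d` points; one spare power of each remains.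
  have h2 : ((d + 1 : ℕ) : ℝ) * Real.log L + (n * (d + 1) : ℕ) * Real.log 2 ≤
      A * Real.log L * q ^ n := by
    calc ((d + 1 : ℕ) : ℝ) * Real.log L + (n * (d + 1) : ℕ) * Real.log 2
        = ((d : ℝ) + 1) * Real.log L + n * (((d : ℝ) + 1) * Real.log 2) := by push_cast; ring
      _ ≤ A * Real.log L + n * (A * (q - 1) * Real.log L) := by
          have h3 : A * (q - 1) ≤ A * (q - 1) * Real.log L :=
            le_mul_of_one_le_right (mul_nonneg hA0 (by linarith)) hlog
          exact add_le_add (mul_le_mul_of_nonneg_right hA1 (by linarith))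
            (mul_le_mul_of_nonneg_left (hA2.trans h3) (Nat.cast_nonneg n))
      _ = A * Real.log L * (1 + n * (q - 1)) := by ring
      _ ≤ A * Real.log L * q ^ n :=
          mul_le_mul_of_nonneg_left h1 (mul_nonneg hA0 (by linarith))
  have h3 : Real.exp (-(A * Real.log L * q ^ n)) ≤ (L ^ (d + 1))⁻¹ * (2 ^ (n * (d + 1)))⁻¹ := by
    refine (Real.exp_le_exp.2 (neg_le_neg h2)).trans (le_of_eq ?_)
    rw [neg_add, Real.exp_add, Real.exp_neg, Real.exp_neg, ← Real.log_pow, ← Real.log_pow,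
      Real.exp_log (by positivity), Real.exp_log (by positivity)]
  calc (K * (2 ^ (n + 1) * L)) ^ d * (2 * Real.exp (-(A * Real.log L * q ^ n)))
      ≤ (K * (2 ^ (n + 1) * L)) ^ d * (2 * ((L ^ (d + 1))⁻¹ * (2 ^ (n * (d + 1)))⁻¹)) := by
        gcongr
    _ = 2 ^ (d + 1) * K ^ d * L⁻¹ * (1 / 2) ^ n := by
        have e1 : (2 : ℝ) ^ (n * (d + 1)) = (2 ^ n) ^ d * 2 ^ n := by
          rw [pow_mul, pow_succ]
        rw [e1, one_div, inv_pow]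
        field_simp
        ring

variable {Rbar : E d → ℝ}

/-- With high probability the noise in the box of size `L` oscillates by at most `δ √log L` on the
cells of a fixed lattice. -/
theorem exists_mesh_oscillation (hRbar : IsCovarianceRoot Rbar)
    (hξ : IsStationaryGaussianNoise P (covarianceFun Rbar) ξ) {δ : ℝ} (hδ : 0 < δ) :
    ∃ a : ℝ, 0 < a ∧ Tendsto (fun L : ℝ => P {ω | ¬ ∀ x ∈ box d L,
      |ξ x ω - ξ (meshPoint a (meshIndex a x)) ω| ≤ δ * √(Real.log L)}) atTop (𝓝 0) := by
  obtain ⟨e, he, C, hC, hR⟩ := hRbar.covarianceFun_zero_sub_le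
  -- At scale `n` the increments have variance of order `ρ ^ (4 n)`, and a deviation of order `ρ ^
  -- n` is allowed. The Gaussian exponent therefore grows like `ρ ^ (-2 n) = q ^ n`.
  set ρ : ℝ := 2 ^ (-(e / 4)) with hρ
  have hρ0 : 0 < ρ := by positivity
  have hρ1 : ρ < 1 := Real.rpow_lt_one_of_one_lt_of_neg one_lt_two (by linarith)
  set q : ℝ := (ρ ^ 2)⁻¹ with hq_def
  have hq : 1 < q := (one_lt_inv₀ (by positivity)).2 (pow_lt_one₀ hρ0.le hρ1 two_ne_zero)
  -- Normalised so that the geometric sum of the allowed deviations is `δ`.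
  set δ' : ℝ := δ * (1 - ρ) with hδ'_def
  have hδ' : 0 < δ' := mul_pos hδ (by linarith)
  set A : ℝ := max ((d : ℝ) + 1) (((d : ℝ) + 1) * Real.log 2 / (q - 1)) with hA_def
  have hA1 : (d : ℝ) + 1 ≤ A := le_max_left _ _
  have hA2 : ((d : ℝ) + 1) * Real.log 2 ≤ A * (q - 1) := by
    rw [← div_le_iff₀ (by linarith)]; exact le_max_right _ _
  have hA0 : 0 < A := lt_of_lt_of_le (by positivity) hA1
  -- The variance at scale `0` for which the exponent is exactly `A log L q ^ n`; the spacing `a` is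
  -- then taken small enough to reach it.
  set w : ℝ := δ' ^ 2 / (2 * A) with hw_def
  have hw : 0 < w := by positivity
  obtain ⟨a, ha, haw⟩ : ∃ a : ℝ, 0 < a ∧ 2 * (C * (√d * a) ^ e) ≤ w := by
    have hc : Continuous fun a : ℝ => 2 * (C * (√d * a) ^ e) :=
      continuous_const.mul (continuous_const.mul
        ((continuous_const.mul continuous_id).rpow_const fun _ => Or.inr he.le))
    have h0 : Tendsto (fun a : ℝ => 2 * (C * (√d * a) ^ e)) (𝓝[>] 0) (𝓝 0) := by
      have := (hc.tendsto 0).mono_left (nhdsWithin_le_nhds (s := Set.Ioi 0))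
      simpa [Real.zero_rpow he.ne'] using this
    obtain ⟨a, h1, h2⟩ := ((h0.eventually (ge_mem_nhds hw)).and self_mem_nhdsWithin).exists
    exact ⟨a, h2, h1⟩
  refine ⟨a, ha, ?_⟩
  set K : ℝ := 2 / a + 3 with hK_def
  have hK : 0 ≤ K := by positivity
  have hpow : ∀ n : ℕ, ((2 : ℝ) ^ n)⁻¹ ^ e = ρ ^ (4 * n) := by
    intro n
    rw [hρ, ← Real.rpow_natCast 2 n, ← Real.rpow_neg zero_le_two, ← Real.rpow_mul zero_le_two,
      ← Real.rpow_natCast, ← Real.rpow_mul zero_le_two]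
    congr 1
    push_cast
    ring
  let bad : ℝ → ℕ → Set Ω := fun L n => ⋃ m ∈ meshBox d (a / 2 ^ (n + 1)) L,
    {ω | δ' * √(Real.log L) * ρ ^ n ≤ |ξ (meshPoint (a / 2 ^ (n + 1)) m) ω -
      ξ (meshPoint (a / 2 ^ n) fun i => m i / 2) ω|}
  have hbad : ∀ L, Real.exp 1 ≤ L → ∀ n,
      P (bad L n) ≤ ENNReal.ofReal (2 ^ (d + 1) * K ^ d * L⁻¹ * (1 / 2) ^ n) := by
    intro L hL n
    have hL0 : 0 < L := (Real.exp_pos 1).trans_le hL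
    have hL1 : 1 ≤ L := (Real.one_le_exp zero_le_one).trans hL
    have hlog : 0 ≤ Real.log L := Real.log_nonneg hL1
    have hpt : ∀ m : Fin d → ℤ, P {ω | δ' * √(Real.log L) * ρ ^ n ≤
        |ξ (meshPoint (a / 2 ^ (n + 1)) m) ω - ξ (meshPoint (a / 2 ^ n) fun i => m i / 2) ω|} ≤
        ENNReal.ofReal (2 * Real.exp (-(A * Real.log L * q ^ n))) := by
      intro m
      set x := meshPoint (a / 2 ^ (n + 1)) m
      set y := meshPoint (a / 2 ^ n) fun i => m i / 2
      have hxy : ‖x - y‖ ≤ √d * a * (2 ^ n)⁻¹ := by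
        have := norm_meshPoint_half_sub_le (a := a / 2 ^ n) (by positivity) m
        rw [div_div, ← pow_succ] at this
        rw [mul_assoc]
        exact this
      have hvar : ∫ ω, (ξ x ω - ξ y ω) * (ξ x ω - ξ y ω) ∂P ≤ w * ρ ^ (4 * n) := by
        rw [hξ.integral_sq_sub]
        have h1 : C * ‖x - y‖ ^ e ≤ C * ((√d * a) ^ e * ρ ^ (4 * n)) := by
          rw [← hpow, ← Real.mul_rpow (by positivity) (by positivity)]
          gcongr
        calc _ ≤ 2 * (C * ((√d * a) ^ e * ρ ^ (4 * n))) :=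
              mul_le_mul_of_nonneg_left ((hR _).trans h1) zero_le_two
          _ = 2 * (C * (√d * a) ^ e) * ρ ^ (4 * n) := by ring
          _ ≤ _ := mul_le_mul_of_nonneg_right haw (by positivity)
      have h2 := measure_abs_ge_le_of_gaussian (s := δ' * √(Real.log L) * ρ ^ n)
        hξ.gaussian.hasGaussianLaw_fun_sub (hξ.integral_sub_eq_zero x y) hvar (by positivity)
      refine h2.trans (le_of_eq ?_)
      rw [ENNReal.ofReal_mul zero_le_two, ENNReal.ofReal_ofNat]
      congr 3
      rw [mul_pow, mul_pow, Real.sq_sqrt hlog, hw_def, hq_def, inv_pow]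
      field_simp
      ring
    calc P (bad L n) ≤ ∑ m ∈ meshBox d (a / 2 ^ (n + 1)) L, _ := measure_biUnion_finset_le _ _
      _ ≤ ∑ m ∈ meshBox d (a / 2 ^ (n + 1)) L,
          ENNReal.ofReal (2 * Real.exp (-(A * Real.log L * q ^ n))) :=
          Finset.sum_le_sum fun m _ => hpt m
      _ = ENNReal.ofReal ((meshBox d (a / 2 ^ (n + 1)) L).card *
          (2 * Real.exp (-(A * Real.log L * q ^ n)))) := by
          rw [Finset.sum_const, nsmul_eq_mul, ENNReal.ofReal_mul (Nat.cast_nonneg _),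
            ENNReal.ofReal_natCast]
      _ ≤ _ := by
          refine ENNReal.ofReal_le_ofReal (le_trans ?_ (chaining_term_le hL hK hq hA1 hA2 n))
          refine mul_le_mul_of_nonneg_right ?_ (by positivity)
          exact card_meshBox_le ha hL1 (one_le_pow₀ one_le_two)
  have hsum : ∀ L, Real.exp 1 ≤ L → P (⋃ n, bad L n) ≤
      ENNReal.ofReal (2 ^ (d + 2) * K ^ d * L⁻¹) := by
    intro L hL
    have hL0 : 0 < L := (Real.exp_pos 1).trans_le hL
    calc P (⋃ n, bad L n) ≤ ∑' n, P (bad L n) := measure_iUnion_le _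
      _ ≤ ∑' n, ENNReal.ofReal (2 ^ (d + 1) * K ^ d * L⁻¹ * (1 / 2) ^ n) :=
          ENNReal.tsum_le_tsum (hbad L hL)
      _ = ENNReal.ofReal (2 ^ (d + 2) * K ^ d * L⁻¹) := by
          rw [← ENNReal.ofReal_tsum_of_nonneg (fun n => by positivity)
            (summable_geometric_two.mul_left _), tsum_mul_left, tsum_geometric_two]
          congr 1
          ring
  have hlim : Tendsto (fun L : ℝ => ENNReal.ofReal (2 ^ (d + 2) * K ^ d * L⁻¹)) atTop (𝓝 0) := by
    have := (tendsto_inv_atTop_zero (𝕜 := ℝ)).const_mul (2 ^ (d + 2) * K ^ d)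
    rw [mul_zero] at this
    simpa using ENNReal.tendsto_ofReal this
  refine tendsto_of_tendsto_of_tendsto_of_le_of_le' tendsto_const_nhds hlim
    (Eventually.of_forall fun _ => zero_le) ?_
  filter_upwards [eventually_ge_atTop (Real.exp 1)] with L hL
  refine le_trans ?_ (hsum L hL)
  refine measure_mono_ae ?_
  filter_upwards [hξ.continuous_paths] with ω hω hωbad
  by_contra hnb
  refine hωbad fun x hx => ?_
  have hgeo := (hasSum_geometric_of_lt_one hρ0.le hρ1).mul_left (δ' * √(Real.log L))
  have hmain := abs_sub_meshPoint_le hω ha x hgeo.summable (fun n => by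
    by_contra! hlt
    refine hnb (Set.mem_iUnion.2 ⟨n, Set.mem_iUnion₂.2 ⟨_, meshIndex_mem_meshBox
      (a := a / 2 ^ (n + 1)) (by positivity) hx, hlt.le⟩⟩))
  rw [hgeo.tsum_eq] at hmain
  refine hmain.trans (le_of_eq ?_)
  rw [hδ'_def]
  have : 1 - ρ ≠ 0 := by linarith
  field_simp

/-- With high probability the noise on a lattice in the box of size `L` is at most `θ √log L`. -/
theorem tendsto_measure_mesh_ge {r₀ : ℝ} (hr₀ : 0 < r₀) (hR0 : R 0 = r₀)
    (hξ : IsStationaryGaussianNoise P R ξ) {a : ℝ} (ha : 0 < a) {θ : ℝ}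
    (hθ0 : 0 ≤ θ) (hθ : 2 * d * r₀ < θ ^ 2) :
    Tendsto (fun L : ℝ => P {ω | ∃ m ∈ meshBox d a L, θ * √(Real.log L) ≤ ξ (meshPoint a m) ω})
      atTop (𝓝 0) := by
  set K : ℝ := 2 / a + 3 with hK_def
  have hK : 0 ≤ K := by positivity
  -- Each tail is at most `L ^ (-θ² / (2 r₀))` and there are order `L ^ d` points, so the union
  -- bound decays like `L ^ (-c)`.
  set c : ℝ := θ ^ 2 / (2 * r₀) - d with hc_def
  have hc : 0 < c := by
    rw [hc_def, sub_pos, lt_div_iff₀ (by positivity)]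
    linarith
  have hlim : Tendsto (fun L : ℝ => ENNReal.ofReal (K ^ d * Real.exp (-(c * Real.log L))))
      atTop (𝓝 0) := by
    have h1 : Tendsto (fun L : ℝ => Real.exp (-(c * Real.log L))) atTop (𝓝 0) :=
      Real.tendsto_exp_neg_atTop_nhds_zero.comp (Real.tendsto_log_atTop.const_mul_atTop hc)
    have := h1.const_mul (K ^ d)
    rw [mul_zero] at this
    simpa using ENNReal.tendsto_ofReal this
  refine tendsto_of_tendsto_of_tendsto_of_le_of_le' tendsto_const_nhds hlim
    (Eventually.of_forall fun _ => zero_le) ?_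
  filter_upwards [eventually_ge_atTop 1] with L hL
  have hL0 : 0 < L := by linarith
  have hlog : 0 ≤ Real.log L := Real.log_nonneg hL
  have hpt : ∀ m : Fin d → ℤ, P {ω | θ * √(Real.log L) ≤ ξ (meshPoint a m) ω} ≤
      ENNReal.ofReal (Real.exp (-(θ ^ 2 / (2 * r₀) * Real.log L))) := by
    intro m
    have hv : ∫ ω, ξ (meshPoint a m) ω * ξ (meshPoint a m) ω ∂P ≤ r₀ := by
      rw [hξ.covariance, sub_self, hR0]
    refine (measure_ge_le_of_gaussian (hξ.gaussian.hasGaussianLaw_eval _) (hξ.centered _) hv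
      (by positivity)).trans (le_of_eq ?_)
    rw [mul_pow, Real.sq_sqrt hlog]
    congr 2
    ring
  have hset : {ω | ∃ m ∈ meshBox d a L, θ * √(Real.log L) ≤ ξ (meshPoint a m) ω} =
      ⋃ m ∈ meshBox d a L, {ω | θ * √(Real.log L) ≤ ξ (meshPoint a m) ω} := by
    ext ω; simp
  rw [hset]
  calc _ ≤ ∑ m ∈ meshBox d a L, P {ω | θ * √(Real.log L) ≤ ξ (meshPoint a m) ω} :=
        measure_biUnion_finset_le _ _
    _ ≤ ∑ m ∈ meshBox d a L, ENNReal.ofReal (Real.exp (-(θ ^ 2 / (2 * r₀) * Real.log L))) :=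
        Finset.sum_le_sum fun m _ => hpt m
    _ = ENNReal.ofReal ((meshBox d a L).card * Real.exp (-(θ ^ 2 / (2 * r₀) * Real.log L))) := by
        rw [Finset.sum_const, nsmul_eq_mul, ENNReal.ofReal_mul (Nat.cast_nonneg _),
          ENNReal.ofReal_natCast]
    _ ≤ _ := by
        refine ENNReal.ofReal_le_ofReal ?_
        have h1 := card_meshBox_le (d := d) ha hL le_rfl
        rw [div_one, one_mul] at h1
        have h2 : L ^ d = Real.exp (d * Real.log L) := by
          rw [← Real.log_pow, Real.exp_log (by positivity)]
        calc _ ≤ (K * L) ^ d * Real.exp (-(θ ^ 2 / (2 * r₀) * Real.log L)) :=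
              mul_le_mul_of_nonneg_right h1 (Real.exp_pos _).le
          _ = _ := by
              rw [mul_pow, h2, mul_assoc, ← Real.exp_add, hc_def]
              congr 2
              ring

/-- Pairwise independent events with many expected occurrences: at least `k` of them occur with
high probability. -/
theorem measure_card_lt_le [IsProbabilityMeasure P] {ι : Type*} [Fintype ι] {Y : ι → Ω → ℝ}
    (hY : ∀ i, AEMeasurable (Y i) P) (hind : ∀ i j, i ≠ j → IndepFun (Y i) (Y j) P)
    {s p : ℝ} (hp : ∀ i, p ≤ P.real {ω | s ≤ Y i ω}) {k : ℕ}
    (hk : 2 * (k : ℝ) < Fintype.card ι * p) :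
    P {ω | ¬ ∃ y : Fin k → ι, Function.Injective y ∧ ∀ l, s ≤ Y (y l) ω} ≤
      ENNReal.ofReal (4 / (Fintype.card ι * p)) := by
  classical
  let f : ℝ → ℝ := (Set.Ici s).indicator fun _ => 1
  have hf : Measurable f := measurable_const.indicator measurableSet_Ici
  let Z : ι → Ω → ℝ := fun i => f ∘ Y i
  have hfb : ∀ x, 0 ≤ f x ∧ f x ≤ 1 := by
    intro x
    by_cases hx : x ∈ Set.Ici s <;> simp [f, hx]
  have hZm : ∀ i, AEMeasurable (Z i) P := fun i => hf.comp_aemeasurable (hY i)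
  have hZ : ∀ i, MemLp (Z i) 2 P := fun i =>
    MemLp.of_bound (hZm i).aestronglyMeasurable 1 (Eventually.of_forall fun ω => by
      have := hfb (Y i ω)
      change ‖f (Y i ω)‖ ≤ 1
      rw [Real.norm_eq_abs, abs_of_nonneg this.1]; exact this.2)
  have hns : ∀ i, NullMeasurableSet {ω | s ≤ Y i ω} P := fun i =>
    (hY i).nullMeasurableSet_preimage measurableSet_Ici
  have hmean : ∀ i, ∫ ω, Z i ω ∂P = P.real {ω | s ≤ Y i ω} := by
    intro i
    have : Z i = {ω | s ≤ Y i ω}.indicator fun _ => 1 := by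
      funext ω
      by_cases h : s ≤ Y i ω <;> simp [Z, f, h]
    rw [this, integral_indicator₀ (hns i)]
    simp
  have hvar : ∀ i, variance (Z i) P ≤ ∫ ω, Z i ω ∂P := by
    intro i
    rw [variance_eq_sub (hZ i)]
    have h1 : ∀ ω, (Z i ^ 2) ω = Z i ω := by
      intro ω
      by_cases h : s ≤ Y i ω <;> simp [Z, f, h]
    simp_rw [h1]
    linarith [sq_nonneg (∫ ω, Z i ω ∂P)]
  set S : Ω → ℝ := ∑ i, Z i with hS
  have hSmem : MemLp S 2 P := memLp_finsetSum' _ fun i _ => hZ i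
  set M : ℝ := ∫ ω, S ω ∂P with hM
  have hMsum : M = ∑ i, ∫ ω, Z i ω ∂P := by
    rw [hM, hS]
    simp_rw [Finset.sum_apply]
    exact integral_finsetSum _ fun i _ => (hZ i).integrable one_le_two
  have hMge : Fintype.card ι * p ≤ M := by
    rw [hMsum]
    calc (Fintype.card ι : ℝ) * p = ∑ _i : ι, p := by simp
      _ ≤ _ := Finset.sum_le_sum fun i _ => by rw [hmean]; exact hp i
  have hcp : 0 < Fintype.card ι * p := lt_of_le_of_lt (by positivity) hk
  have hM0 : 0 < M := hcp.trans_le hMge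
  have hVS : variance S P ≤ M := by
    rw [hS, IndepFun.variance_sum (fun i _ => hZ i) (fun i _ j _ hij =>
      (hind i j hij).comp hf hf), hMsum]
    exact Finset.sum_le_sum fun i _ => hvar i
  -- Pairwise independence bounds the variance of the count by its mean `M`. As `k < M / 2`, a count
  -- below `k` deviates by at least `M / 2`, with probability at most `4 / M`.
  have hcheb := meas_ge_le_variance_div_sq hSmem (c := M / 2) (by positivity)
  refine (measure_mono ?_).trans (hcheb.trans (ENNReal.ofReal_le_ofReal ?_))
  · intro ω hω
    have hlt : S ω < k := by
      by_contra! hge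
      refine hω ?_
      have hScard : S ω = (Finset.univ.filter fun i => s ≤ Y i ω).card := by
        rw [hS, Finset.sum_apply, Finset.card_filter]
        push_cast
        refine Finset.sum_congr rfl fun i _ => ?_
        by_cases h : s ≤ Y i ω <;> simp [Z, f, h]
      rw [hScard] at hge
      obtain ⟨t, ht, htk⟩ := Finset.exists_subset_card_eq (Nat.cast_le.1 hge)
      let eqv := (Finset.equivFinOfCardEq htk).symm
      refine ⟨fun l => eqv l, Subtype.val_injective.comp eqv.injective, fun l => ?_⟩
      exact (Finset.mem_filter.1 (ht (eqv l).2)).2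
    change M / 2 ≤ |S ω - M|
    rw [abs_sub_comm]
    refine le_trans ?_ (le_abs_self _)
    linarith
  · calc variance S P / (M / 2) ^ 2 ≤ M / (M / 2) ^ 2 := by gcongr
      _ = 4 / M := by field_simp; norm_num
      _ ≤ 4 / (Fintype.card ι * p) := by gcongr

/-- With high probability there are `k` lattice cells in the box of size `L` at whose base points
the noise is at least `θ √log L`. -/
theorem tendsto_measure_not_exists_mesh_ge {r₀ : ℝ} (hr₀ : 0 < r₀) (hR0 : R 0 = r₀)
    (hRc : ∃ r : ℝ, 0 < r ∧ ∀ x, r ≤ ‖x‖ → R x = 0)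
    (hξ : IsStationaryGaussianNoise P R ξ) {a : ℝ} (ha : 0 < a) {θ : ℝ}
    (hθ0 : 0 ≤ θ) (hθ : θ ^ 2 < 2 * d * r₀) (k : ℕ) :
    Tendsto (fun L : ℝ => P {ω | ¬ ∃ y : Fin k → Fin d → ℤ, Function.Injective y ∧
      ∀ l, (∀ i, 0 ≤ a * y l i ∧ a * (y l i + 1) ≤ L) ∧
        θ * √(Real.log L) ≤ ξ (meshPoint a (y l)) ω}) atTop (𝓝 0) := by
  have := hξ.gaussian.isProbabilityMeasure
  obtain ⟨r, hr, hRr⟩ := hRc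
  -- Every `M`-th lattice point is kept: the spacing `a M ≥ r` exceeds the range of dependence.
  set M : ℕ := ⌈r / a⌉₊ with hM_def
  have hM : 0 < M := Nat.ceil_pos.2 (by positivity)
  have hMr : r ≤ a * M := by
    have := Nat.le_ceil (r / a)
    rw [div_le_iff₀ ha] at this
    rw [hM_def]; linarith
  have haM : 0 < a * M := by positivity
  set N : ℝ → ℕ := fun L => ⌊L / (a * M)⌋₊ with hN
  set p : ℝ → ℝ := fun L => (√(2 * Real.pi * r₀))⁻¹ *
    Real.exp (-(θ * √(Real.log L) + 1) ^ 2 / (2 * r₀)) with hp_def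
  -- With `u = √log L`, the logarithm of the expected count is at least `c u² - θ u / r₀` up to a
  -- constant, so `c > 0` absorbs the loss in the lower tail bound.
  have hNp : Tendsto (fun L => ((N L) ^ d : ℕ) * p L) atTop atTop := by
    set c : ℝ := d - θ ^ 2 / (2 * r₀) with hc_def
    have hc : 0 < c := by
      rw [hc_def, sub_pos, div_lt_iff₀ (by positivity)]
      linarith
    have hu : Tendsto (fun L : ℝ => √(Real.log L)) atTop atTop :=
      Real.tendsto_sqrt_atTop.comp Real.tendsto_log_atTop
    have hpoly : Tendsto (fun u : ℝ => u * (c * u - θ / r₀) - 1 / (2 * r₀)) atTop atTop := by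
      refine tendsto_atTop_add_const_right _ _ ?_
      refine tendsto_id.atTop_mul_atTop₀ ?_
      exact tendsto_atTop_add_const_right _ _ (tendsto_id.const_mul_atTop hc)
    have hC : 0 < ((2 * (a * M))⁻¹) ^ d * (√(2 * Real.pi * r₀))⁻¹ := by
      have : 0 < √(2 * Real.pi * r₀) := Real.sqrt_pos.2 (by positivity)
      positivity
    have hexp := (Real.tendsto_exp_atTop.comp (hpoly.comp hu)).const_mul_atTop hC
    refine tendsto_atTop_mono' _ ?_ hexp
    filter_upwards [eventually_ge_atTop 1, eventually_ge_atTop (2 * (a * M))] with L hL1 hL2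
    have hL0 : 0 < L := by linarith
    have hlog : 0 ≤ Real.log L := Real.log_nonneg hL1
    have hNL : (2 * (a * M))⁻¹ * L ≤ N L := by
      have h1 : L / (a * M) < N L + 1 := Nat.lt_floor_add_one _
      have h2 : 2 ≤ L / (a * M) := by rw [le_div_iff₀ haM]; exact hL2
      have h3 : (2 * (a * M))⁻¹ * L = L / (a * M) / 2 := by field_simp
      rw [h3]; linarith
    have h4 : L ^ d = Real.exp (d * √(Real.log L) ^ 2) := by
      rw [Real.sq_sqrt hlog, ← Real.log_pow, Real.exp_log (by positivity)]
    calc ((2 * (a * M))⁻¹) ^ d * (√(2 * Real.pi * r₀))⁻¹ *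
          Real.exp (√(Real.log L) * (c * √(Real.log L) - θ / r₀) - 1 / (2 * r₀))
        = ((2 * (a * M))⁻¹ * L) ^ d * p L := by
          rw [mul_pow, h4, hp_def]
          have : √(Real.log L) * (c * √(Real.log L) - θ / r₀) - 1 / (2 * r₀) =
              d * √(Real.log L) ^ 2 + -(θ * √(Real.log L) + 1) ^ 2 / (2 * r₀) := by
            rw [hc_def]; field_simp; ring
          rw [this, Real.exp_add]
          ring
      _ ≤ ((N L) ^ d : ℕ) * p L := by
          push_cast
          have hp0 : 0 ≤ p L := by positivity
          gcongr
  have hlim : Tendsto (fun L => ENNReal.ofReal (4 / (((N L) ^ d : ℕ) * p L))) atTop (𝓝 0) := by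
    have := hNp.const_div_atTop (4 : ℝ)
    simpa using ENNReal.tendsto_ofReal this
  refine tendsto_of_tendsto_of_tendsto_of_le_of_le' tendsto_const_nhds hlim
    (Eventually.of_forall fun _ => zero_le) ?_
  filter_upwards [eventually_ge_atTop 1, hNp.eventually_gt_atTop (2 * k)] with L hL1 hbig
  have hL0 : 0 < L := by linarith
  -- Only the nonnegative orthant is used; this costs a constant factor and keeps whole cells inside
  -- the box.
  let idx : (Fin d → Fin (N L)) → Fin d → ℤ := fun j i => (M : ℤ) * (j i : ℕ)
  have hidx : Function.Injective idx := by
    intro j j' h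
    funext i
    have h1 : (M : ℤ) * (j i : ℕ) = (M : ℤ) * (j' i : ℕ) := congrFun h i
    have h2 := mul_left_cancel₀ (by exact_mod_cast hM.ne') h1
    exact Fin.ext (by exact_mod_cast h2)
  have hcard : Fintype.card (Fin d → Fin (N L)) = (N L) ^ d := by simp
  have hsep : ∀ j j', j ≠ j' → r ≤ ‖meshPoint (d := d) a (idx j) - meshPoint a (idx j')‖ := by
    intro j j' hne
    obtain ⟨i, hi⟩ := Function.ne_iff.1 hne
    have h1 : (1 : ℝ) ≤ |((j i : ℕ) : ℝ) - ((j' i : ℕ) : ℝ)| := by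
      have : ((j i : ℕ) : ℤ) - ((j' i : ℕ) : ℤ) ≠ 0 := by
        rw [sub_ne_zero]
        exact fun h => hi (Fin.ext (by exact_mod_cast h))
      exact_mod_cast Int.one_le_abs this
    have h2 := PiLp.norm_apply_le (meshPoint (d := d) a (idx j) - meshPoint a (idx j')) i
    refine le_trans ?_ h2
    rw [PiLp.sub_apply, meshPoint_apply, meshPoint_apply, Real.norm_eq_abs]
    have h3 : a * ((idx j i : ℤ) : ℝ) - a * ((idx j' i : ℤ) : ℝ) =
        a * M * (((j i : ℕ) : ℝ) - ((j' i : ℕ) : ℝ)) := by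
      simp only [idx]; push_cast; ring
    rw [h3, abs_mul, abs_of_pos haM]
    nlinarith
  have hmain := measure_card_lt_le (P := P) (ι := Fin d → Fin (N L))
    (Y := fun j => ξ (meshPoint a (idx j))) (s := θ * √(Real.log L)) (p := p L) (k := k)
    (fun j => hξ.gaussian.aemeasurable _)
    (fun j j' hne => hξ.indepFun (hRr _ (hsep j j' hne)))
    (fun j => le_measureReal_ge_of_gaussian (hξ.gaussian.hasGaussianLaw_eval _) (hξ.centered _)
      (by rw [hξ.covariance, sub_self, hR0]) hr₀ (by positivity))
    (by rw [hcard]; exact hbig)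
  rw [hcard] at hmain
  refine (measure_mono ?_).trans hmain
  intro ω hω hex
  obtain ⟨y, hy, hys⟩ := hex
  refine hω ⟨fun l => idx (y l), hidx.comp hy, fun l => ⟨fun i => ?_, hys l⟩⟩
  have h1 : ((idx (y l) i : ℤ) : ℝ) = M * ((y l i : ℕ) : ℝ) := by simp [idx]
  rw [h1]
  refine ⟨by positivity, ?_⟩
  have h2 : ((y l i : ℕ) : ℝ) + 1 ≤ N L := by exact_mod_cast (y l i).2
  have h3 : (N L : ℝ) ≤ L / (a * M) := Nat.floor_le (by positivity)
  have h4 : a * M * (((y l i : ℕ) : ℝ) + 1) ≤ L := by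
    have := (le_div_iff₀ haM).1 (h2.trans h3)
    linarith
  have h5 : (1 : ℝ) ≤ M := by exact_mod_cast hM
  nlinarith

end Noise

/-! ### Eigenvalue asymptotics. -/

variable {d : ℕ}

theorem isBounded_box (d : ℕ) (t : ℝ) : Bornology.IsBounded (box d t) := by
  refine (Metric.isBounded_closedBall (x := meshPoint (d := d) 0 0) (r := √d * |t|)).subset ?_
  intro x hx
  rw [mem_closedBall_iff_norm]
  refine norm_sub_meshPoint_le (fun i => ?_) (abs_nonneg t)
  have h := hx i
  rw [zero_mul, sub_zero]
  exact (abs_lt.2 ⟨h.1, h.2⟩).le.trans (le_abs_self t)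

theorem measurableSet_box (d : ℕ) (t : ℝ) : MeasurableSet (box d t) := by
  have : box d t = ⋂ i, (fun x : E d => x i) ⁻¹' Set.Ioo (-t) t := by
    ext x; simp [box]
  rw [this]
  exact MeasurableSet.iInter fun i => (by fun_prop : Measurable fun x : E d => x i) measurableSet_Ioo

/-- The eigenvalue asymptotics for a fixed noise configuration that is controlled on a lattice. -/
theorem abs_dirichletEigenvalue_sub_le (hd : 4 ≤ d) {κ : ℝ} (hκ0 : 0 < κ)
    (hκ : ∀ (y : E d) (ρ : ℝ), 0 < ρ → ∃ φ : E d → ℝ, IsTestFunction (Metric.ball y ρ) φ ∧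
      1 / 2 * ∫ x, ‖∇ φ x‖ ^ 2 < κ / ρ ^ 2 * ∫ x, φ x ^ 2)
    {f : E d → ℝ} (hf : Continuous f) {ε t a δ σ u : ℝ} (hε0 : 0 < ε) (hε1 : ε ≤ 1)
    (ha : 0 < a) (hδ : 0 < δ) (hσ : 0 ≤ σ) (hu : 0 < u) (hκu : κ / (a / 2) ^ 2 ≤ δ * u)
    {k : ℕ} (hk : 1 ≤ k)
    (hosc : ∀ x ∈ box d (t / ε), |f x - f (meshPoint a (meshIndex a x))| ≤ δ * u)
    (hup : ∀ m ∈ meshBox d a (t / ε), f (meshPoint a m) ≤ (σ + δ) * u)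
    {y : Fin k → Fin d → ℤ} (hy : Function.Injective y)
    (hyL : ∀ l, ∀ i, 0 ≤ a * y l i ∧ a * (y l i + 1) ≤ t / ε)
    (hlow : ∀ l, (σ - δ) * u ≤ f (meshPoint a (y l))) :
    |dirichletEigenvalue (fun x => ε ^ (-(d : ℝ) / 2) * f (ε⁻¹ • x)) (box d t) k /
      (ε ^ (-(d : ℝ) / 2) * u) - σ| ≤ 3 * δ := by
  set c : ℝ := ε ^ (-(d : ℝ) / 2) with hc_def
  have hc : 0 < c := Real.rpow_pos_of_pos hε0 _
  have hcu : 0 < c * u := mul_pos hc hu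
  have hV : Continuous fun x : E d => c * f (ε⁻¹ • x) :=
    continuous_const.mul (hf.comp (continuous_const_smul _))
  have hupper : dirichletEigenvalue (fun x => c * f (ε⁻¹ • x)) (box d t) k ≤
      c * ((σ + 2 * δ) * u) := by
    refine dirichletEigenvalue_le hV (isBounded_box d t) (measurableSet_box d t)
      (by positivity) (fun x hx => ?_) hk
    have hx' : ε⁻¹ • x ∈ box d (t / ε) := by
      intro i
      have h := hx i
      rw [PiLp.smul_apply, smul_eq_mul, inv_mul_eq_div, ← neg_div]
      exact ⟨div_lt_div_of_pos_right h.1 hε0, div_lt_div_of_pos_right h.2 hε0⟩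
    have h1 := (abs_le.1 (hosc _ hx')).2
    have h2 := hup _ (meshIndex_mem_meshBox ha hx')
    refine mul_le_mul_of_nonneg_left ?_ hc.le
    linarith
  have hρ : 0 < ε * (a / 2) := by positivity
  -- Centers of the rescaled cells. The ball of radius `ε a / 2` stays in one open cell, so distinct
  -- indices give disjoint balls and the oscillation bound compares with a single lattice value.
  let z : Fin k → E d := fun l => WithLp.toLp 2 fun i => ε * (a * y l i + a / 2)
  have hball : ∀ l, ∀ x ∈ Metric.ball (z l) (ε * (a / 2)), ∀ i,
      a * y l i < x i / ε ∧ x i / ε < a * (y l i + 1) := by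
    intro l x hx i
    have h1 := (PiLp.norm_apply_le (x - z l) i).trans_lt (mem_ball_iff_norm.1 hx)
    rw [PiLp.sub_apply, Real.norm_eq_abs, abs_lt] at h1
    have h2 : z l i = ε * (a * y l i + a / 2) := rfl
    rw [h2] at h1
    rw [lt_div_iff₀ hε0, div_lt_iff₀ hε0]
    constructor <;> nlinarith [h1.1, h1.2]
  have hidx : ∀ l, ∀ x ∈ Metric.ball (z l) (ε * (a / 2)), meshIndex a (ε⁻¹ • x) = y l := by
    intro l x hx
    funext i
    have h := hball l x hx i
    rw [meshIndex, PiLp.smul_apply, smul_eq_mul, inv_mul_eq_div, Int.floor_eq_iff,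
      le_div_iff₀ ha, div_lt_iff₀ ha]
    constructor <;> linarith [h.1, h.2]
  have hbox : ∀ l, ∀ x ∈ Metric.ball (z l) (ε * (a / 2)), x ∈ box d t := by
    intro l x hx i
    have h := hball l x hx i
    have h2 := hyL l i
    have h3 : 0 < x i / ε := h2.1.trans_lt h.1
    have h4 : x i / ε < t / ε := h.2.trans_le h2.2
    have h5 : 0 < x i := (div_pos_iff_of_pos_right hε0).1 h3
    have h6 : x i < t := (div_lt_div_iff_of_pos_right hε0).1 h4
    exact ⟨by linarith, h6⟩
  have hlower : c * ((σ - 2 * δ) * u) - κ / (ε * (a / 2)) ^ 2 ≤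
      dirichletEigenvalue (fun x => c * f (ε⁻¹ • x)) (box d t) k := by
    refine le_dirichletEigenvalue hκ hV (isBounded_box d t) (measurableSet_box d t) hk hρ z hbox
      (fun l l' hne => Set.disjoint_left.2 fun x hx hx' => hne (hy ?_)) (fun l x hx => ?_)
    · rw [← hidx l x hx, ← hidx l' x hx']
    · have hx' : ε⁻¹ • x ∈ box d (t / ε) := by
        intro i
        have h := hbox l x hx i
        rw [PiLp.smul_apply, smul_eq_mul, inv_mul_eq_div, ← neg_div]
        exact ⟨div_lt_div_of_pos_right h.1 hε0, div_lt_div_of_pos_right h.2 hε0⟩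
      have h1 := (abs_le.1 (hosc _ hx')).1
      rw [hidx l x hx] at h1
      have h2 := hlow l
      refine mul_le_mul_of_nonneg_left ?_ hc.le
      linarith
  -- The dimension enters here: `d ≥ 4` and `ε ≤ 1` give `ε^{-2} ≤ ε^{-d/2}`. This is the third `δ`,
  -- after the lattice value and the oscillation.
  have hkin : κ / (ε * (a / 2)) ^ 2 ≤ c * (δ * u) := by
    have h1 : (ε ^ 2)⁻¹ ≤ c := by
      have h2 : (ε ^ 2)⁻¹ = ε ^ (-2 : ℝ) := by
        rw [Real.rpow_neg hε0.le]; norm_num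
      rw [h2, hc_def]
      refine Real.rpow_le_rpow_of_exponent_ge hε0 hε1 ?_
      have : (4 : ℝ) ≤ d := by exact_mod_cast hd
      linarith
    calc κ / (ε * (a / 2)) ^ 2 = (ε ^ 2)⁻¹ * (κ / (a / 2) ^ 2) := by field_simp
      _ ≤ c * (δ * u) := by gcongr
  rw [abs_le]
  constructor
  · have : σ - 3 * δ ≤ dirichletEigenvalue (fun x => c * f (ε⁻¹ • x)) (box d t) k / (c * u) := by
      rw [le_div_iff₀ hcu]
      linarith
    linarith
  · have : dirichletEigenvalue (fun x => c * f (ε⁻¹ • x)) (box d t) k / (c * u) ≤ σ + 3 * δ := by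
      rw [div_le_iff₀ hcu]
      have : 0 < c * (δ * u) := by positivity
      linarith
    linarith

/-- The rescaled eigenvalue deviates from its limit with vanishing probability. -/
theorem tendsto_measure_dirichletEigenvalue_sub_ge {d : ℕ} (hd : 4 ≤ d)
    {Ω : Type*} [MeasurableSpace Ω] (P : Measure Ω)
    (Rbar : E d → ℝ) (hRbar : IsCovarianceRoot Rbar) (ξ : E d → Ω → ℝ)
    (hξ : IsStationaryGaussianNoise P (covarianceFun Rbar) ξ)
    (ε : ℝ → ℝ) (hε : ∀ t, 0 ≤ t → ε t ∈ Set.Ioc (0 : ℝ) 1) (k : ℕ) (hk : 1 ≤ k)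
    {η : ℝ} (hη : 0 < η) :
    Tendsto (fun t => P {ω | η ≤ dist (dirichletEigenvalue (scaledNoise ξ (ε t) ω) (box d t) k /
      ((ε t) ^ (-(d : ℝ) / 2) * √(Real.log (t / ε t))))
        (√(2 * d * covarianceFun Rbar 0))}) atTop (𝓝 0) := by
  set r₀ := covarianceFun Rbar 0 with hr₀_def
  have hr₀ : 0 < r₀ := hRbar.covarianceFun_zero_pos
  have hd0 : (0 : ℝ) < d := by
    have : (4 : ℝ) ≤ d := by exact_mod_cast hd
    linarith
  set σ := √(2 * d * r₀) with hσ_def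
  have hσ : 0 < σ := Real.sqrt_pos.2 (by positivity)
  have hσ2 : σ ^ 2 = 2 * d * r₀ := Real.sq_sqrt (by positivity)
  obtain ⟨κ, hκ0, hκ⟩ := exists_bump d
  -- `η / 4` makes the total error `3 δ` smaller than `η`; `σ / 2` keeps the level `σ - δ` positive.
  set δ := min (η / 4) (σ / 2) with hδ_def
  have hδ : 0 < δ := lt_min (by positivity) (by positivity)
  have hδη : 3 * δ < η := by have := min_le_left (η / 4) (σ / 2); linarith
  have hδσ : δ < σ := by have := min_le_right (η / 4) (σ / 2); linarith
  obtain ⟨a, ha, hosc⟩ := exists_mesh_oscillation hRbar hξ hδ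
  have hup := tendsto_measure_mesh_ge hr₀ rfl hξ ha (θ := σ + δ) (by positivity) (by nlinarith)
  have hlow := tendsto_measure_not_exists_mesh_ge hr₀ rfl
    hRbar.exists_covarianceFun_eq_zero hξ ha (θ := σ - δ) (by linarith) (by nlinarith) k
  have hL : Tendsto (fun t => t / ε t) atTop atTop := by
    refine tendsto_atTop_mono' _ ?_ tendsto_id
    filter_upwards [eventually_ge_atTop 0] with t ht
    exact le_div_self ht (hε t ht).1 (hε t ht).2
  have hu : Tendsto (fun t => √(Real.log (t / ε t))) atTop atTop :=
    Real.tendsto_sqrt_atTop.comp (Real.tendsto_log_atTop.comp hL)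
  have hsum := ((hosc.comp hL).add (hup.comp hL)).add (hlow.comp hL)
  simp only [add_zero] at hsum
  refine tendsto_of_tendsto_of_tendsto_of_le_of_le' tendsto_const_nhds hsum
    (Eventually.of_forall fun _ => zero_le) ?_
  filter_upwards [eventually_ge_atTop 0, hu.eventually_gt_atTop 0,
    hu.eventually_ge_atTop (κ / (a / 2) ^ 2 / δ)] with t ht hu0 huκ
  -- Only outer-measure monotonicity is used, so measurability of the eigenvalue in `ω` is never
  -- required.
  refine le_trans (measure_mono_ae ?_) ((measure_union_le _ _).trans
    (add_le_add_left (measure_union_le _ _) _))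
  filter_upwards [hξ.continuous_paths] with ω hω hbad
  by_contra hnot
  have hnot' : ω ∉ {ω | ¬ ∀ x ∈ box d (t / ε t),
      |ξ x ω - ξ (meshPoint a (meshIndex a x)) ω| ≤ δ * √(Real.log (t / ε t))} ∧
      ω ∉ {ω | ∃ m ∈ meshBox d a (t / ε t),
        (σ + δ) * √(Real.log (t / ε t)) ≤ ξ (meshPoint a m) ω} ∧
      ω ∉ {ω | ¬ ∃ y : Fin k → Fin d → ℤ, Function.Injective y ∧
        ∀ l, (∀ i, 0 ≤ a * y l i ∧ a * (y l i + 1) ≤ t / ε t) ∧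
        (σ - δ) * √(Real.log (t / ε t)) ≤ ξ (meshPoint a (y l)) ω} :=
    ⟨fun h => hnot (Or.inl (Or.inl h)), fun h => hnot (Or.inl (Or.inr h)),
      fun h => hnot (Or.inr h)⟩
  obtain ⟨h1, h2, h3⟩ := hnot'
  simp only [Set.mem_ofPred_eq, not_not] at h1 h3
  simp only [Set.mem_ofPred_eq, not_exists, not_and, not_le] at h2
  obtain ⟨y, hy, hyl⟩ := h3
  have hmain := abs_dirichletEigenvalue_sub_le hd hκ0 hκ hω (hε t ht).1 (hε t ht).2 ha hδ hσ.le hu0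
    (by rw [div_le_iff₀ hδ] at huκ; linarith) hk h1 (fun m hm => (h2 m hm).le) hy
    (fun l => (hyl l).1) (fun l => (hyl l).2)
  exact absurd (le_trans hbad hmain) (not_le.2 hδη)

end AndersonHamiltonian

theorem theorem4p2 {d : ℕ} (hd : 4 ≤ d)
    {Ω : Type*} [MeasurableSpace Ω] (P : Measure Ω) [IsProbabilityMeasure P]
    (Rbar : AndersonHamiltonian.E d → ℝ)
    (hRbar : AndersonHamiltonian.IsCovarianceRoot Rbar)
    (ξ : AndersonHamiltonian.E d → Ω → ℝ)
    (hξ : AndersonHamiltonian.IsStationaryGaussianNoise P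
      (AndersonHamiltonian.covarianceFun Rbar) ξ)
    (ε : ℝ → ℝ) (hε : ∀ t, 0 ≤ t → ε t ∈ Set.Ioc (0 : ℝ) 1)
    (k : ℕ) (hk : 1 ≤ k) :
    TendstoInMeasure P
      (fun (t : ℝ) (ω : Ω) =>
        AndersonHamiltonian.dirichletEigenvalue
            (AndersonHamiltonian.scaledNoise ξ (ε t) ω) (AndersonHamiltonian.box d t) k /
          ((ε t) ^ (-(d : ℝ) / 2) * Real.sqrt (Real.log (t / ε t))))
      atTop
      (fun _ => Real.sqrt (2 * d * AndersonHamiltonian.covarianceFun Rbar 0)) :=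
  tendstoInMeasure_iff_dist.2 fun _ hη =>
    AndersonHamiltonian.tendsto_measure_dirichletEigenvalue_sub_ge hd P Rbar hRbar ξ hξ ε hε k hk hη
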